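/- All vector spaces are over $\mathbb C$. A nonlocal vertex algebra is a vector space $V$ with a linear map $Y(\cdot,x):V\to \mathrm{Hom}(V,V((x)))$ and a vector $\mathbf 1\in V$ such that $Y(\mathbf 1,x)v=v$, $Y(v,x)\mathbf 1\in V[[x]]$ and $\lim_{x\to 0}Y(v,x)\mathbf 1=v$ for all $v\in V$, and such that for all $u,v,w\in V$ there is an integer $l\ge 0$ with $(x_0+x_2)^lY(u,x_0+x_2)Y(v,x_2)w=(x_0+x_2)^lY(Y(u,x_0)v,x_2)w$ (powers of $x_0+x_2$ being expanded in nonnegative powers of $x_2$). It is called nondegenerate if for every integer $n\ge 1$ the linear map $$Z_n: V^{\otimes n}\otimes \mathbb C((x_1))\cdots((x_n))\to V((x_1))\cdots((x_n)),\qquad Z_n(u_1\otimes\cdots\otimes u_n\otimes f)=f\,Y(u_1,x_1)\cdots Y(u_n,x_n)\mathbf 1,$$ is injective. If $\mathcal L$ is a Lie algebra with a derivation $d$, extend $d$ to a derivation of the universal enveloping algebra $U(\mathcal L)$; then $U(\mathcal L)$ is a nonlocal vertex algebra with vacuum vector $1$ and $Y(a,x)b=(e^{xd}a)b$ for $a,b\in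 U(\mathcal L)$. (1) Let $\mathcal L$ be a Lie algebra with a derivation $d$ such that $\mathcal L$ is a free $\mathbb C[d]$-module with a countable basis (that is, free with a countable basis over the polynomial ring in one variable acting through $d$). Then the nonlocal vertex algebra $U(\mathcal L)$ is nondegenerate. (2) Let $\mathfrak g$ be a Lie algebra of countable (possibly finite) dimension. Equip the Lie algebra $\mathfrak g\otimes t^{-1}\mathbb C[t^{-1}]$, with bracket $[a\otimes f,b\otimes g]=[a,b]\otimes fg$, with the derivation $1\otimes d/dt$. Then the nonlocal vertex algebra $U(\mathfrak g\otimes t^{-1}\mathbb C[t^{-1}])$ is nondegenerate. -/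

import Mathlib

open scoped TensorProduct VertexOperator LaurentPolynomial Polynomial

universe u

namespace NonlocalVA

noncomputable section

/-! ### Nonlocal vertex algebras -/

/-- A nonlocal vertex algebra structure on a complex vector space `V`.  Here `VertexOperator ℂ V` is
the space `Hom(V, V((x)))`, and `(Y u)[[n]]` is the mode `uₙ`, i.e. the coefficient of `x ^ (-n - 1)`
in `Y(u, x)`. -/
structure NonlocalVertexAlgebra (V : Type u) [AddCommGroup V] [Module ℂ V] where
  /-- The vertex operator map `Y(·, x) : V → Hom(V, V((x)))`. -/
  Y : V →ₗ[ℂ] VertexOperator ℂ V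
  /-- The vacuum vector. -/
  vac : V
  /-- `Y(1, x) v = v`. -/
  vacuum : ∀ v : V, Y vac v = HahnModule.of ℂ (HahnSeries.single 0 v)
  /-- `Y(v, x) 1 ∈ V[[x]]`. -/
  creation_regular : ∀ (v : V) (n : ℤ), 0 ≤ n → ((Y v)[[n]]) vac = 0
  /-- `Y(v, x) 1 → v` as `x → 0`. -/
  creation_limit : ∀ v : V, ((Y v)[[-1]]) vac = v
  /-- Weak associativity
  `(x₀ + x₂) ^ l Y(u, x₀ + x₂) Y(v, x₂) w = (x₀ + x₂) ^ l Y(Y(u, x₀) v, x₂) w`,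
  where powers of `x₀ + x₂` are expanded in nonnegative powers of `x₂`: the two sides are the
  coefficients of `x₀ ^ p * x₂ ^ q`.  The sum on the left is finite since `v_{i-q-1} w = 0` for `i`
  large; its binomial coefficients come from `(x₀ + x₂) ^ (p + i)`. -/
  weak_assoc : ∀ u v w : V, ∃ l : ℕ, ∀ p q : ℤ,
    ∑ᶠ i : ℕ, Ring.choose (p + i) i • ((Y u)[[l - 1 - p - i]]) (((Y v)[[i - q - 1]]) w) =
      ∑ j ∈ Finset.range (l + 1),
        l.choose j • ((Y (((Y u)[[l - j - 1 - p]]) v))[[j - q - 1]]) w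

/-! ### Iterated Laurent series -/

/-- The field `ℂ((x₁))⋯((xₙ))` as a `ℂ`-algebra: `ℂ((x₁))⋯((xₙ₊₁))` consists of the Laurent series
in `xₙ₊₁` with coefficients in `ℂ((x₁))⋯((xₙ))`. -/
def IterScalar : ℕ → CommAlgCat.{0} ℂ
  | 0 => CommAlgCat.of ℂ ℂ
  | n + 1 =>
    letI : Algebra ℂ (LaurentSeries (IterScalar n)) := HahnSeries.instAlgebra
    CommAlgCat.of ℂ (LaurentSeries (IterScalar n))

/-- The space `V((x₁))⋯((xₙ))` as a module over `ℂ((x₁))⋯((xₙ))`.  `HahnModule ℤ R M` is the space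
`M((x))`, with its structure of module over `R((x))`. -/
def IterLaurent (V : Type u) [AddCommGroup V] [Module ℂ V] : (n : ℕ) → ModuleCat.{u} (IterScalar n)
  | 0 => ModuleCat.of ℂ V
  | n + 1 => ModuleCat.of (LaurentSeries (IterScalar n)) (HahnModule ℤ (IterScalar n) (IterLaurent V n))

section

variable (V : Type u) [AddCommGroup V] [Module ℂ V] (n : ℕ)

instance : Module ℂ (IterLaurent V n) :=
  Module.compHom _ (algebraMap ℂ (IterScalar n))

instance : IsScalarTower ℂ (IterScalar n) (IterLaurent V n) :=
  IsScalarTower.of_algebraMap_smul fun _ _ => rfl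

end

variable {V : Type u} [AddCommGroup V] [Module ℂ V]


/-- A Laurent series in `xₙ₊₁` with coefficients in `V((x₁))⋯((xₙ))`, as an element of
`V((x₁))⋯((xₙ₊₁))`. -/
def IterLaurent.ofSeries (n : ℕ) :
    HahnSeries ℤ (IterLaurent V n) ≃+ IterLaurent V (n + 1) where
  __ := HahnModule.of (IterScalar n)
  map_add' _ _ := rfl

theorem IterLaurent.ofSeries_complex_smul (n : ℕ) (c : ℂ) (x : HahnSeries ℤ (IterLaurent V n)) :
    IterLaurent.ofSeries n (c • x) = c • IterLaurent.ofSeries n x := by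
  have h : (HahnSeries.single (0 : ℤ) (algebraMap ℂ (IterScalar n) c)) •
      HahnModule.of (IterScalar n) x = HahnModule.of (IterScalar n) (c • x) := by
    rw [HahnModule.single_zero_smul_eq_smul]
    rfl
  have h2 : algebraMap ℂ (IterScalar (n + 1)) c =
      HahnSeries.single (0 : ℤ) (algebraMap ℂ (IterScalar n) c) :=
    rfl
  have h3 : c • IterLaurent.ofSeries n x =
      (algebraMap ℂ (IterScalar (n + 1)) c) • IterLaurent.ofSeries n x := rfl
  rw [h3, h2]
  exact h.symm

/-! ### Products of vertex operators and nondegeneracy -/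

/-- Apply a linear map `V → V((x₁))⋯((xₙ))` to the coefficients of a Laurent series in `xₙ₊₁`. -/
def applyCoeffs {n : ℕ} (φ : V →ₗ[ℂ] IterLaurent V n) :
    HahnModule ℤ ℂ V →ₗ[ℂ] IterLaurent V (n + 1) where
  toFun s := IterLaurent.ofSeries n (((HahnModule.of ℂ).symm s).map φ)
  map_add' s t := by
    rw [← map_add]
    congr 1
    ext k
    simp
  map_smul' c s := by
    rw [RingHom.id_apply, ← IterLaurent.ofSeries_complex_smul]
    congr 1
    ext k
    exact φ.map_smul c _

theorem applyCoeffs_add {n : ℕ} (φ ψ : V →ₗ[ℂ] IterLaurent V n) :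
    applyCoeffs (φ + ψ) = applyCoeffs φ + applyCoeffs ψ := by
  ext s
  change IterLaurent.ofSeries n _ = IterLaurent.ofSeries n _ + IterLaurent.ofSeries n _
  rw [← map_add]
  congr 1

theorem applyCoeffs_smul {n : ℕ} (c : ℂ) (φ : V →ₗ[ℂ] IterLaurent V n) :
    applyCoeffs (c • φ) = c • applyCoeffs φ := by
  ext s
  change IterLaurent.ofSeries n _ = c • IterLaurent.ofSeries n _
  rw [← IterLaurent.ofSeries_complex_smul]
  congr 1

namespace NonlocalVertexAlgebra

variable (𝒱 : NonlocalVertexAlgebra V)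

/-- The product `Y(u₁, x₁) ⋯ Y(uₙ, xₙ) w ∈ V((x₁))⋯((xₙ))`, multilinear in `u₁, …, uₙ` and linear in
`w`: one expands `Y(uₙ, xₙ) w` in powers of `xₙ` and applies `Y(u₁, x₁) ⋯ Y(uₙ₋₁, xₙ₋₁)` to its
coefficients. -/
def iterY : (n : ℕ) → MultilinearMap ℂ (fun _ : Fin n => V) (V →ₗ[ℂ] IterLaurent V n)
  | 0 => MultilinearMap.constOfIsEmpty ℂ _
      { toFun := fun w => w
        map_add' := fun _ _ => rfl
        map_smul' := fun _ _ => rfl }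
  | n + 1 =>
    { toFun := fun u => applyCoeffs (iterY n (Fin.init u)) ∘ₗ 𝒱.Y (u (Fin.last n))
      map_update_add' := by
        intro inst u i a b
        obtain rfl : inst = instDecidableEqFin (n + 1) := Subsingleton.elim _ _
        induction i using Fin.lastCases with
        | last => simp [LinearMap.comp_add]
        | cast i =>
          have h : ∀ z : V, Function.update u i.castSucc z (Fin.last n) = u (Fin.last n) :=
            fun z => Function.update_of_ne (Fin.castSucc_lt_last i).ne' _ _
          simp [applyCoeffs_add, LinearMap.add_comp, h]
      map_update_smul' := by
        intro inst u i c a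
        obtain rfl : inst = instDecidableEqFin (n + 1) := Subsingleton.elim _ _
        induction i using Fin.lastCases with
        | last => simp [LinearMap.comp_smul]
        | cast i =>
          have h : ∀ z : V, Function.update u i.castSucc z (Fin.last n) = u (Fin.last n) :=
            fun z => Function.update_of_ne (Fin.castSucc_lt_last i).ne' _ _
          simp [applyCoeffs_smul, LinearMap.smul_comp, h] }

theorem iterY_coeff (n : ℕ) (u : Fin (n + 1) → V) (w : V) (k : ℤ) :
    ((IterLaurent.ofSeries n).symm (𝒱.iterY (n + 1) u w)).coeff k =
      𝒱.iterY n (Fin.init u) (((𝒱.Y (u (Fin.last n)))[[-k - 1]]) w) := by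
  rw [← VertexOperator.coeff_eq_ncoeff]
  rfl

/-- The linear map `Zₙ : V^{⊗ n} ⊗ ℂ((x₁))⋯((xₙ)) → V((x₁))⋯((xₙ))`,
`u₁ ⊗ ⋯ ⊗ uₙ ⊗ f ↦ f Y(u₁, x₁) ⋯ Y(uₙ, xₙ) 1`. -/
def Z (n : ℕ) : (⨂[ℂ] _ : Fin n, V) ⊗[ℂ] (IterScalar n) →ₗ[ℂ] IterLaurent V n :=
  TensorProduct.lift
    ((Algebra.lsmul ℂ ℂ (IterLaurent V n)).toLinearMap.flip ∘ₗ
      PiTensorProduct.lift ((LinearMap.applyₗ 𝒱.vac).compMultilinearMap (𝒱.iterY n)))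

theorem Z_tmul (n : ℕ) (u : Fin n → V) (f : IterScalar n) :
    𝒱.Z n (PiTensorProduct.tprod ℂ u ⊗ₜ[ℂ] f) = f • 𝒱.iterY n u 𝒱.vac := by
  simp [Z]

/-- Nondegeneracy: `Zₙ` is injective for every positive integer `n`. -/
def Nondegenerate : Prop :=
  ∀ n : ℕ, 0 < n → Function.Injective (𝒱.Z n)

end NonlocalVertexAlgebra

/-! ### The nonlocal vertex algebra of an associative algebra with a derivation -/

section Associative

variable {A : Type u} [Ring A] [Algebra ℂ A]

/-- The coefficient of `x ^ k` in the vertex operator `b ↦ (e^{x D} a) b`. -/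
def expMode (D : A →ₗ[ℂ] A) (a : A) : ℤ → Module.End ℂ A
  | .ofNat k => LinearMap.mulLeft ℂ (((k.factorial : ℂ)⁻¹) • (D ^ k) a)
  | .negSucc _ => 0

/-- The vertex operator map `Y(a, x) b = (e^{x D} a) b`. -/
def expY (D : A →ₗ[ℂ] A) : A →ₗ[ℂ] VertexOperator ℂ A where
  toFun a := VertexOperator.of_coeff (expMode D a) fun b => by
    refine ⟨0, fun k hk => ?_⟩
    cases k with
    | ofNat k => exact Int.natCast_nonneg k
    | negSucc k => exact absurd rfl hk
  map_add' a b := by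
    ext c k
    change expMode D (a + b) k c = expMode D a k c + expMode D b k c
    cases k <;> simp [expMode, add_mul]
  map_smul' r a := by
    ext c k
    change expMode D (r • a) k c = r • expMode D a k c
    cases k <;> simp [expMode, smul_comm r]

theorem expY_ncoeff (D : A →ₗ[ℂ] A) (a b : A) (n : ℤ) :
    ((expY D a)[[n]]) b = expMode D a (-n - 1) b := rfl

theorem leibniz_pow {D : A →ₗ[ℂ] A} (hD : ∀ a b, D (a * b) = D a * b + a * D b) (n : ℕ) (a b : A) :
    (D ^ n) (a * b) =
      ∑ ij ∈ Finset.HasAntidiagonal.antidiagonal n,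
        n.choose ij.1 • ((D ^ ij.1) a * (D ^ ij.2) b) := by
  induction n with
  | zero => simp
  | succ n ih =>
    rw [Finset.sum_antidiagonal_choose_succ_nsmul (M := A) (fun i j => (D ^ i) a * (D ^ j) b) n]
    simp only [pow_succ', Module.End.mul_apply, ih, map_sum, map_nsmul, hD, smul_add,
      Finset.sum_add_distrib]
    rw [add_comm, add_right_inj]
    refine Finset.sum_congr rfl fun ⟨i, j⟩ hij => ?_
    rw [n.choose_symm_of_eq_add (Finset.HasAntidiagonal.mem_antidiagonal.1 hij).symm]

theorem expMode_nat_mul {D : A →ₗ[ℂ] A} (hD : ∀ a b, D (a * b) = D a * b + a * D b) (p q : ℕ)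
    (u v w : A) :
    ∑ i ∈ Finset.range (q + 1),
        (p + i).choose i • expMode D u ((p + i : ℕ) : ℤ) (expMode D v ((q - i : ℕ) : ℤ) w) =
      expMode D (expMode D u (p : ℤ) v) (q : ℤ) w := by
  have hE : ∀ (x y : A) (k : ℕ), expMode D x (k : ℤ) y = ((k.factorial : ℂ)⁻¹ • (D ^ k) x) * y :=
    fun _ _ _ => rfl
  simp only [hE]
  rw [smul_mul_assoc ((p.factorial : ℂ)⁻¹) ((D ^ p) u) v, map_smul, leibniz_pow hD, Finset.Nat.sum_antidiagonal_eq_sum_range_succ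
    (fun i j => q.choose i • ((D ^ i) ((D ^ p) u) * (D ^ j) v)) q]
  simp only [Finset.smul_sum, Finset.sum_mul]
  refine Finset.sum_congr rfl fun i hi => ?_
  have hiq : i ≤ q := Nat.lt_succ_iff.mp (Finset.mem_range.mp hi)
  have e : (D ^ i) ((D ^ p) u) = (D ^ (p + i)) u := by
    rw [add_comm, pow_add]; rfl
  rw [e]
  simp only [← Nat.cast_smul_eq_nsmul ℂ, smul_mul_assoc, mul_smul_comm, smul_smul, ← mul_assoc]
  congr 1
  have h1 := Nat.add_choose_mul_factorial_mul_factorial p i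
  have h2 := Nat.choose_mul_factorial_mul_factorial hiq
  have f1 : ∀ k : ℕ, (k.factorial : ℂ) ≠ 0 := fun k => by exact_mod_cast k.factorial_ne_zero
  rw [← h1, ← h2]
  have c1 : ((p + i).choose i : ℂ) ≠ 0 := by
    exact_mod_cast (Nat.choose_pos (Nat.le_add_left i p)).ne'
  have c2 : (q.choose i : ℂ) ≠ 0 := by exact_mod_cast (Nat.choose_pos hiq).ne'
  push_cast
  field_simp [f1]

/-- The nonlocal vertex algebra `(A, D)` of an associative algebra `A` with a derivation `D`: the
vacuum is `1` and `Y(a, x) b = (e^{x D} a) b`. -/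
def ofDerivation (D : A →ₗ[ℂ] A) (hD : ∀ a b, D (a * b) = D a * b + a * D b) :
    NonlocalVertexAlgebra A where
  Y := expY D
  vac := 1
  vacuum v := by
    have h1 : D 1 = 0 := by simpa using hD 1 1
    ext k
    change expMode D 1 k v = (HahnSeries.single 0 v).coeff k
    rcases k with (_ | k) | k
    · change LinearMap.mulLeft ℂ _ _ = (HahnSeries.single 0 v).coeff 0
      simp
    · rw [HahnSeries.coeff_single_of_ne (by rw [Int.ofNat_eq_natCast]; positivity)]
      simp [expMode, pow_succ, h1]
    · rw [HahnSeries.coeff_single_of_ne (by simp)]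
      rfl
  creation_regular v n hn := by
    rw [expY_ncoeff]
    obtain ⟨k, rfl⟩ := Int.eq_ofNat_of_zero_le hn
    have : -(k : ℤ) - 1 = Int.negSucc k := by rw [Int.negSucc_eq]; ring
    rw [this]
    rfl
  creation_limit v := by
    rw [expY_ncoeff]
    change expMode D v 0 1 = v
    change LinearMap.mulLeft ℂ _ _ = _
    simp
  weak_assoc u v w := by
    refine ⟨0, fun p q => ?_⟩
    have e1 : ∀ i : ℕ, -(((0 : ℕ) : ℤ) - 1 - p - i) - 1 = p + i := fun i => by push_cast; ring
    have e2 : ∀ i : ℕ, -((i : ℤ) - q - 1) - 1 = q - i := fun i => by ring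
    have e3 : -(((0 : ℕ) : ℤ) - ((0 : ℕ) : ℤ) - 1 - p) - 1 = p := by push_cast; ring
    have e4 : q - ((0 : ℕ) : ℤ) = q := by simp
    have hneg : ∀ (x y : A) (k : ℤ), k < 0 → expMode D x k y = 0 := by
      intro x y k hk
      cases k with
      | ofNat k => exact absurd hk (by simp)
      | negSucc k => rfl
    simp only [expY_ncoeff, zero_add, Finset.sum_range_one, Nat.choose_self, one_smul, e1, e2, e3, e4]
    have hsupp : ∀ i : ℕ, q < i →
        Ring.choose (p + i) i • expMode D u (p + i) (expMode D v (q - i) w) = 0 := by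
      intro i hi
      rw [hneg v w _ (by lia), map_zero, smul_zero]
    rcases lt_or_ge q 0 with hq | hq
    · rw [hneg _ w q hq, finsum_eq_zero_of_forall_eq_zero fun i => hsupp i (by lia)]
    · obtain ⟨q, rfl⟩ := Int.eq_ofNat_of_zero_le hq
      rw [finsum_eq_sum_of_support_subset (s := Finset.range (q + 1)) _ (by
        intro i hi
        by_contra hc
        refine hi (hsupp i ?_)
        simp at hc
        lia)]
      rcases lt_or_ge p 0 with hp | hp
      · have h0 : expMode D (expMode D u p v) (q : ℤ) w = 0 := by
          rw [hneg u v p hp]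
          simp [expMode]
        rw [h0]
        refine Finset.sum_eq_zero fun i _ => ?_
        rcases lt_or_ge (p + i) 0 with hpi | hpi
        · rw [hneg u _ _ hpi, smul_zero]
        · obtain ⟨k, hk⟩ := Int.eq_ofNat_of_zero_le hpi
          rw [hk, Ring.choose_natCast, Nat.choose_eq_zero_of_lt (by lia)]
          simp
      · obtain ⟨p, rfl⟩ := Int.eq_ofNat_of_zero_le hp
        rw [← expMode_nat_mul hD]
        refine Finset.sum_congr rfl fun i hi => ?_
        have hiq : i ≤ q := Nat.lt_succ_iff.mp (Finset.mem_range.mp hi)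
        have a1 : (p : ℤ) + i = ((p + i : ℕ) : ℤ) := by push_cast; ring
        have a2 : (q : ℤ) - i = ((q - i : ℕ) : ℤ) := by lia
        rw [a1, a2, Ring.choose_natCast, natCast_zsmul]

end Associative

/-! ### Enveloping algebras -/

section Enveloping

variable {L : Type u} [LieRing L] [LieAlgebra ℂ L]

attribute [local instance 100] LieRing.ofAssociativeRing

open UniversalEnvelopingAlgebra in
/-- The Lie algebra map `a ↦ a + ε d(a)` from `L` to the dual numbers over `U(L)`. -/
def derivLie (d : LieDerivation ℂ L L) :
    L →ₗ⁅ℂ⁆ TrivSqZeroExt (UniversalEnvelopingAlgebra ℂ L) (UniversalEnvelopingAlgebra ℂ L) where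
  toFun a := TrivSqZeroExt.inl (ι ℂ a) + TrivSqZeroExt.inr (ι ℂ (d a))
  map_add' a b := by ext <;> simp
  map_smul' c a := by ext <;> simp
  map_lie' {a b} := by
    ext
    · simp [LieRing.of_associative_ring_bracket]
    · simp only [LieHom.map_lie, LieRing.of_associative_ring_bracket, TrivSqZeroExt.snd_add,
        TrivSqZeroExt.snd_inl, TrivSqZeroExt.snd_inr, zero_add, LieDerivation.apply_lie_eq_sub,
        map_sub, TrivSqZeroExt.snd_sub, TrivSqZeroExt.snd_mul, TrivSqZeroExt.fst_add,
        TrivSqZeroExt.fst_inl, TrivSqZeroExt.fst_inr, add_zero, smul_eq_mul,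
        MulOpposite.smul_eq_mul_unop, MulOpposite.unop_op]
      abel

/-- The derivation of `U(L)` extending the derivation `d` of `L`. -/
def envDeriv (d : LieDerivation ℂ L L) :
    UniversalEnvelopingAlgebra ℂ L →ₗ[ℂ] UniversalEnvelopingAlgebra ℂ L where
  toFun a := (UniversalEnvelopingAlgebra.lift ℂ (derivLie d) a).snd
  map_add' _ _ := by simp
  map_smul' _ _ := by simp

theorem lift_derivLie_fst (d : LieDerivation ℂ L L) (a : UniversalEnvelopingAlgebra ℂ L) :
    (UniversalEnvelopingAlgebra.lift ℂ (derivLie d) a).fst = a := by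
  have h : (TrivSqZeroExt.fstHom ℂ (UniversalEnvelopingAlgebra ℂ L)
      (UniversalEnvelopingAlgebra ℂ L)).comp (UniversalEnvelopingAlgebra.lift ℂ (derivLie d)) =
      AlgHom.id ℂ _ := by
    ext x
    change (UniversalEnvelopingAlgebra.lift ℂ (derivLie d) (UniversalEnvelopingAlgebra.ι ℂ x)).fst =
      UniversalEnvelopingAlgebra.ι ℂ x
    rw [UniversalEnvelopingAlgebra.lift_ι_apply]
    change (TrivSqZeroExt.inl (UniversalEnvelopingAlgebra.ι ℂ x) +
      TrivSqZeroExt.inr (UniversalEnvelopingAlgebra.ι ℂ (d x))).fst = _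
    rw [TrivSqZeroExt.fst_add, TrivSqZeroExt.fst_inl, TrivSqZeroExt.fst_inr, add_zero]
  exact DFunLike.congr_fun h a

theorem envDeriv_ι (d : LieDerivation ℂ L L) (a : L) :
    envDeriv d (UniversalEnvelopingAlgebra.ι ℂ a) = UniversalEnvelopingAlgebra.ι ℂ (d a) := by
  change (UniversalEnvelopingAlgebra.lift ℂ (derivLie d) (UniversalEnvelopingAlgebra.ι ℂ a)).snd = _
  rw [UniversalEnvelopingAlgebra.lift_ι_apply]
  change (TrivSqZeroExt.inl (UniversalEnvelopingAlgebra.ι ℂ a) +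
    TrivSqZeroExt.inr (UniversalEnvelopingAlgebra.ι ℂ (d a))).snd = _
  rw [TrivSqZeroExt.snd_add, TrivSqZeroExt.snd_inl, TrivSqZeroExt.snd_inr, zero_add]

theorem envDeriv_mul (d : LieDerivation ℂ L L) (a b : UniversalEnvelopingAlgebra ℂ L) :
    envDeriv d (a * b) = envDeriv d a * b + a * envDeriv d b := by
  change (UniversalEnvelopingAlgebra.lift ℂ (derivLie d) (a * b)).snd = _
  rw [map_mul, TrivSqZeroExt.snd_mul, lift_derivLie_fst, lift_derivLie_fst, add_comm]
  rfl

/-- The nonlocal vertex algebra `U(L)` of a Lie algebra `L` with a derivation `d`: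
`Y(a, x) b = (e^{x d} a) b`, where `d` is extended to a derivation of `U(L)`. -/
def enveloping (d : LieDerivation ℂ L L) :
    NonlocalVertexAlgebra (UniversalEnvelopingAlgebra ℂ L) :=
  ofDerivation (envDeriv d) (envDeriv_mul d)

end Enveloping

/-! ### The Lie algebra `𝔤 ⊗ t⁻¹ ℂ[t⁻¹]` -/

section Current

/-- The linear map `d/dt` on `ℂ[t, t⁻¹]`, `tⁿ ↦ n tⁿ⁻¹`. -/
def laurentDerivLinear : ℂ[T;T⁻¹] →ₗ[ℂ] ℂ[T;T⁻¹] :=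
  Finsupp.linearCombination ℂ (fun n : ℤ => (n : ℂ) • (LaurentPolynomial.T (n - 1) : ℂ[T;T⁻¹])) ∘ₗ
    (AddMonoidAlgebra.coeffLinearEquiv ℂ).toLinearMap

theorem laurentDerivLinear_T (n : ℤ) :
    laurentDerivLinear (LaurentPolynomial.T n) = (n : ℂ) • LaurentPolynomial.T (n - 1) := by
  have h : AddMonoidAlgebra.coeffLinearEquiv ℂ (LaurentPolynomial.T n : ℂ[T;T⁻¹]) =
      Finsupp.single n (1 : ℂ) := rfl
  change Finsupp.linearCombination ℂ _ (AddMonoidAlgebra.coeffLinearEquiv ℂ _) = _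
  rw [h, Finsupp.linearCombination_single, one_smul]

/-- The derivation `d/dt` of `ℂ[t, t⁻¹]`. -/
def laurentDeriv : Derivation ℂ ℂ[T;T⁻¹] ℂ[T;T⁻¹] :=
  Derivation.mk' laurentDerivLinear fun f g => by
    induction f using LaurentPolynomial.induction_on' with
    | add f₁ f₂ h₁ h₂ =>
      simp only [add_mul, map_add, h₁, h₂, smul_eq_mul, mul_add]
      ring
    | C_mul_T m r =>
      induction g using LaurentPolynomial.induction_on' with
      | add g₁ g₂ h₁ h₂ =>
        simp only [add_mul, map_add, h₁, h₂, smul_eq_mul, mul_add]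
        ring
      | C_mul_T n s =>
        simp only [← LaurentPolynomial.smul_eq_C_mul, smul_mul_assoc, mul_smul_comm, map_smul,
          ← LaurentPolynomial.T_add, laurentDerivLinear_T, smul_eq_mul, smul_smul]
        have e1 : m + (n - 1) = m + n - 1 := by ring
        have e2 : n + (m - 1) = m + n - 1 := by ring
        rw [e1, e2, ← add_smul]
        congr 1
        push_cast
        ring

theorem laurentDeriv_T (n : ℤ) :
    laurentDeriv (LaurentPolynomial.T n) = (n : ℂ) • LaurentPolynomial.T (n - 1) :=
  laurentDerivLinear_T n

variable (𝔤 : Type u) [LieRing 𝔤] [LieAlgebra ℂ 𝔤]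

/-- `t⁻¹ ℂ[t⁻¹] ⊗ 𝔤`, as a Lie subalgebra of `ℂ[t, t⁻¹] ⊗ 𝔤` with bracket
`[f ⊗ a, g ⊗ b] = f g ⊗ [a, b]`. -/
def negCurrent : LieSubalgebra ℂ (ℂ[T;T⁻¹] ⊗[ℂ] 𝔤) where
  toSubmodule := Submodule.span ℂ
    {z | ∃ (n : ℕ) (a : 𝔤), z = LaurentPolynomial.T (-(n + 1 : ℤ)) ⊗ₜ[ℂ] a}
  lie_mem' := by
    intro x y hx hy
    change x ∈ Submodule.span ℂ _ at hx
    change y ∈ Submodule.span ℂ _ at hy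
    change ⁅x, y⁆ ∈ Submodule.span ℂ _
    induction hx using Submodule.span_induction with
    | zero => rw [show ⁅(0 : ℂ[T;T⁻¹] ⊗[ℂ] 𝔤), y⁆ = 0 from zero_lie y]; exact Submodule.zero_mem _
    | add x₁ x₂ _ _ h₁ h₂ => rw [show ⁅x₁ + x₂, y⁆ = ⁅x₁, y⁆ + ⁅x₂, y⁆ from add_lie x₁ x₂ y]; exact Submodule.add_mem _ h₁ h₂
    | smul c x _ h => rw [show ⁅c • x, y⁆ = c • ⁅x, y⁆ from smul_lie c x y]; exact Submodule.smul_mem _ c h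
    | mem x hx =>
      obtain ⟨m, a, rfl⟩ := hx
      generalize hx : (LaurentPolynomial.T (-(m + 1 : ℤ)) : ℂ[T;T⁻¹]) ⊗ₜ[ℂ] a = x
      induction hy using Submodule.span_induction with
      | zero => rw [show ⁅x, (0 : ℂ[T;T⁻¹] ⊗[ℂ] 𝔤)⁆ = 0 from lie_zero x]; exact Submodule.zero_mem _
      | add y₁ y₂ _ _ h₁ h₂ => rw [show ⁅x, y₁ + y₂⁆ = ⁅x, y₁⁆ + ⁅x, y₂⁆ from lie_add x y₁ y₂]; exact Submodule.add_mem _ h₁ h₂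
      | smul c y _ h => rw [show ⁅x, c • y⁆ = c • ⁅x, y⁆ from lie_smul c x y]; exact Submodule.smul_mem _ c h
      | mem y hy =>
        obtain ⟨n, b, rfl⟩ := hy
        refine Submodule.subset_span ⟨m + n + 1, ⁅a, b⁆, ?_⟩
        rw [← hx, LieAlgebra.ExtendScalars.bracket_tmul, ← LaurentPolynomial.T_add]
        congr 2

/-- The derivation `d/dt` of `ℂ[t, t⁻¹] ⊗ 𝔤` preserves `t⁻¹ ℂ[t⁻¹] ⊗ 𝔤`. -/
theorem ddt_mem (z : ℂ[T;T⁻¹] ⊗[ℂ] 𝔤) (hz : z ∈ negCurrent 𝔤) :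
    Lie.Derivation.ofDerivation 𝔤 laurentDeriv z ∈ negCurrent 𝔤 := by
  change z ∈ Submodule.span ℂ _ at hz
  change _ ∈ Submodule.span ℂ _
  induction hz using Submodule.span_induction with
  | zero => rw [map_zero]; exact Submodule.zero_mem _
  | add x y _ _ hx hy => rw [map_add]; exact Submodule.add_mem _ hx hy
  | smul c x _ hx => rw [map_smul]; exact Submodule.smul_mem _ c hx
  | mem x hx =>
    obtain ⟨n, a, rfl⟩ := hx
    have h : Lie.Derivation.ofDerivation 𝔤 laurentDeriv
        (LaurentPolynomial.T (-(n + 1 : ℤ)) ⊗ₜ[ℂ] a) =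
        ((-(n + 1 : ℤ) : ℤ) : ℂ) • (LaurentPolynomial.T (-((n + 1 : ℕ) + 1 : ℤ)) ⊗ₜ[ℂ] a) := by
      rw [Lie.Derivation.ofDerivation_apply]
      change laurentDeriv (LaurentPolynomial.T (-(n + 1 : ℤ))) ⊗ₜ[ℂ] a = _
      rw [laurentDeriv_T, TensorProduct.smul_tmul']
      congr 3
    rw [h]
    exact Submodule.smul_mem _ _ (Submodule.subset_span ⟨n + 1, a, rfl⟩)

/-- The derivation `d/dt` of the Lie algebra `t⁻¹ ℂ[t⁻¹] ⊗ 𝔤`. -/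
def negCurrentDeriv : LieDerivation ℂ (negCurrent 𝔤) (negCurrent 𝔤) where
  toFun z := ⟨Lie.Derivation.ofDerivation 𝔤 laurentDeriv z.1, ddt_mem 𝔤 z.1 z.2⟩
  map_add' _ _ := by ext; simp
  map_smul' _ _ := by ext; simp
  leibniz' x y := by
    ext
    exact (Lie.Derivation.ofDerivation 𝔤 laurentDeriv).leibniz' x.1 y.1

end Current

end

end NonlocalVA

/-! The algebra `U(L)` acts by differential operators on the symmetric algebra `R` of `L ⊕ ℂ`: the
Lie algebra `L` acts on `L ⊕ ℂ` by the adjoint representation of `L ⋊ ℂ d`, and this extends to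
derivations of `R`. An operator of order at most `k` has a symbol, and evaluating it at a covector
`df` amounts to applying the operator to `fᵏ / k!` at a zero of `f`. Symbols are multiplicative. For
`f = (0, 1)`, a vector on which `a ∈ L` acts as `d a`, this gives for every linear form `μ` of `L`
functionals `F k` of `U(L)` which kill products of fewer than `k` elements of `L` and map
`a₁ ⋯ aₖ` to the product of the `μ (d aᵢ)` (`exists_leadingFunctional`). If `d` is injective, then
`μ ∘ d` is an arbitrary linear form; so these functionals carry all the information of the
Poincaré–Birkhoff–Witt theorem that is needed here, and the only other fact about `U(L)` that is
used is that monomials in a basis of `L` span it (`span_range_mono`).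

Let `L` have a basis `e (j, m)` with `d (e (j, m)) = e (j, m + 1)`. An element of the domain of `Zₙ`
is a combination `∑ f_M M` of tensor products `M` of monomials with coefficients in the field
`K = ℂ((x₁))⋯((xₙ))`, that is, a polynomial `f` over `K` in variables indexed by `(i, j, m)`.
Applying `F D` with `D` the degree of `f` to the coefficients of its image under `Zₙ` evaluates the
leading form of `f` at `F 1 (e^{xᵢ d} e (j, m))` (`coeffMap_iterY_tensorMono`). For suitable `μ`
these are the values at `xᵢ` of the `m`-th derivatives of arbitrary polynomials `pⱼ ∈ ℂ[X]`. By
Hermite interpolation at the distinct points `xᵢ` of `K`, and since `ℂ` is infinite, a polynomial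
over `K` that vanishes at all these points is zero (`eq_zero_of_aeval_iterate_derivative_eq_zero`).
So the leading form of an element of the kernel of `Zₙ` is zero, and the kernel is trivial.

A Lie algebra that is free over `ℂ[d]` has such a basis, and so has `t⁻¹ ℂ[t⁻¹] ⊗ 𝔤`, namely the
elements `(d/dt)ᵐ t⁻¹ ⊗ bⱼ`. -/

namespace NonlocalVA

noncomputable section

/-! ### Hermite interpolation and algebraic independence -/

section Interpolation

open Polynomial in
/-- Hermite interpolation: the first `N` derivatives of a polynomial can be prescribed at finitely
many distinct points. -/
theorem exists_eval_iterate_derivative_eq {K ι : Type*} [Field K] [CharZero K] [Finite ι]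
    {x : ι → K} (hx : Function.Injective x) (N : ℕ) (y : ι → ℕ → K) :
    ∃ q : K[X], ∀ i, ∀ m < N, (derivative^[m] q).eval (x i) = y i m := by
  -- By the Chinese remainder theorem there is a `q` that agrees modulo `(X - xᵢ) ^ N` with the
  -- polynomial `rᵢ` which has the prescribed Taylor expansion at `xᵢ`.
  let r : ι → K[X] := fun i =>
    taylor (-x i) (∑ m ∈ Finset.range N, monomial m ((m.factorial : K)⁻¹ * y i m))
  have hcop : Pairwise fun i j =>
      IsCoprime (Ideal.span {(X - C (x i)) ^ N}) (Ideal.span {(X - C (x j)) ^ N}) := by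
    intro i j hij
    rw [Ideal.isCoprime_span_singleton_iff]
    exact (isCoprime_X_sub_C_of_isUnit_sub (sub_ne_zero.2 (hx.ne hij)).isUnit).pow
  obtain ⟨q, hq⟩ := Ideal.exists_forall_sub_mem_ideal hcop r
  refine ⟨q, fun i m hm => ?_⟩
  obtain ⟨s, hs⟩ := Ideal.mem_span_singleton.1 (hq i)
  have h0 : taylor (x i) q = X ^ N * taylor (x i) s +
      ∑ m ∈ Finset.range N, monomial m ((m.factorial : K)⁻¹ * y i m) := by
    rw [← sub_eq_iff_eq_add]
    have h1 := congrArg (taylor (x i)) hs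
    rw [map_sub, taylor_mul, taylor_pow, map_sub, taylor_X, taylor_C, taylor_taylor] at h1
    simpa using h1
  have e : derivative^[m] q = m.factorial • hasseDeriv m q :=
    (congrFun (factorial_smul_hasseDeriv m) q).symm
  rw [e, eval_smul,
    ← taylor_coeff, h0, coeff_add,
    coeff_X_pow_mul', if_neg (by lia), zero_add, finsetSum_coeff,
    Finset.sum_eq_single_of_mem m (Finset.mem_range.2 hm)
      (fun b _ hb => coeff_monomial_of_ne _ hb.symm), coeff_monomial_same, nsmul_eq_mul,
    mul_inv_cancel_left₀ (by exact_mod_cast m.factorial_ne_zero)]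

open Polynomial in
/-- If `x₁, …, xₙ` are distinct elements of an extension `K` of an infinite field `k`, then the
values at `x₁, …, xₙ` of all derivatives of "generic" polynomials `pⱼ ∈ k[X]` satisfy no polynomial
relation over `K`. -/
theorem eq_zero_of_aeval_iterate_derivative_eq_zero {k K ι J : Type*} [Field k] [Infinite k]
    [CommRing K] (hfield : IsField K) [CharZero K] [Algebra k K] [Finite ι]
    {x : ι → K} (hx : Function.Injective x)
    (P : MvPolynomial (ι × J × ℕ) K)
    (hP : ∀ p : J → k[X], MvPolynomial.eval
      (fun t : ι × J × ℕ => aeval (x t.1) (derivative^[t.2.2] (p t.2.1))) P = 0) :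
    P = 0 := by
  let := hfield.toField
  -- The relation extends to polynomials with coefficients in `K`: it is polynomial in the
  -- coefficients of the `pⱼ`, and `k` is infinite.
  have hK : ∀ q : J → K[X], MvPolynomial.eval
      (fun t : ι × J × ℕ => (derivative^[t.2.2] (q t.2.1)).eval (x t.1)) P = 0 := by
    intro q
    -- The left-hand side as a polynomial in the coefficients of polynomials with the same supports
    -- as the `qⱼ`.
    let Q : MvPolynomial (J × ℕ) K := MvPolynomial.bind₁
      (fun t : ι × J × ℕ => ∑ l ∈ (q t.2.1).support,
        MvPolynomial.C ((derivative^[t.2.2] (X ^ l : K[X])).eval (x t.1)) *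
          MvPolynomial.X (t.2.1, l)) P
    have key : ∀ c : J × ℕ → K, MvPolynomial.eval c Q = MvPolynomial.eval
        (fun t : ι × J × ℕ => (derivative^[t.2.2]
          (∑ l ∈ (q t.2.1).support, C (c (t.2.1, l)) * X ^ l)).eval (x t.1)) P := by
      intro c
      simp only [Q, MvPolynomial.bind₁, ← MvPolynomial.aeval_eq_eval]
      rw [← AlgHom.comp_apply, MvPolynomial.comp_aeval]
      congr 2
      ext t
      simp only [map_sum, map_mul, MvPolynomial.aeval_C, MvPolynomial.aeval_X,
        iterate_derivative_sum, eval_finsetSum, iterate_derivative_C_mul, eval_mul, eval_C,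
        Algebra.algebraMap_self, RingHom.id_apply]
      exact Finset.sum_congr rfl fun _ _ => mul_comm _ _
    have hQ : Q = 0 := by
      refine MvPolynomial.funext_set (fun _ => Set.range (algebraMap k K))
        (fun _ => Set.infinite_range_of_injective (algebraMap k K).injective) fun c hc => ?_
      choose a ha using fun t => hc t (Set.mem_univ t)
      rw [key, map_zero]
      rw [← hP fun j => ∑ l ∈ (q j).support, C (a (j, l)) * X ^ l]
      congr 1
      congr 1
      ext t
      simp only [aeval_def, eval₂_eq_eval_map, ← iterate_derivative_map, Polynomial.map_sum,
        Polynomial.map_mul, map_C, Polynomial.map_pow, map_X, ha]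
    have h1 := key fun t => (q t.1).coeff t.2
    rw [hQ, map_zero] at h1
    rw [h1]
    congr 1
    congr 1
    ext t
    conv_lhs => rw [(q t.2.1).as_sum_support_C_mul_X_pow]
  -- By Hermite interpolation over `K`, every point agrees on the variables of `P` with the jets of
  -- suitable polynomials `qⱼ`.
  refine MvPolynomial.funext fun y => ?_
  rw [map_zero]
  obtain ⟨N, hN⟩ : ∃ N, ∀ t ∈ P.vars, t.2.2 < N :=
    ⟨P.vars.sup (fun t => t.2.2) + 1, fun t ht =>
      Nat.lt_succ_of_le (Finset.le_sup (f := fun t : ι × J × ℕ => t.2.2) ht)⟩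
  choose q hq using fun j => exists_eval_iterate_derivative_eq hx N fun i m => y (i, j, m)
  rw [← hK q]
  refine MvPolynomial.eval₂Hom_congr' rfl (fun t ht _ => ?_) rfl
  exact (hq t.2.1 t.1 t.2.2 (hN t ht)).symm

end Interpolation

/-! ### Iterated Laurent series -/

theorem isField_iterScalar : (n : ℕ) → IsField (IterScalar n)
  | 0 => Field.toIsField ℂ
  | n + 1 => by
    have ih := isField_iterScalar n
    let := ih.toField
    exact Field.toIsField (LaurentSeries (IterScalar n))

/-- The embedding of `ℂ[[x]]` into `ℂ((x₁))⋯((xₙ))` that sends `x` to `xᵢ`. -/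
def insertVar : (n : ℕ) → Fin n → (PowerSeries ℂ →+* IterScalar n)
  | 0 => Fin.elim0
  | n + 1 => Fin.lastCases (motive := fun _ => PowerSeries ℂ →+* LaurentSeries (IterScalar n))
      ((HahnSeries.ofPowerSeries ℤ (IterScalar n)).comp
        (PowerSeries.map (algebraMap ℂ (IterScalar n))))
      (fun i => HahnSeries.C.comp (insertVar n i))

theorem insertVar_last (n : ℕ) (s : PowerSeries ℂ) :
    insertVar (n + 1) (Fin.last n) s =
      HahnSeries.ofPowerSeries ℤ (IterScalar n)
        (PowerSeries.map (algebraMap ℂ (IterScalar n)) s) := by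
  simp only [insertVar, Fin.lastCases_last]
  rfl

theorem insertVar_castSucc (n : ℕ) (i : Fin n) (s : PowerSeries ℂ) :
    insertVar (n + 1) i.castSucc s =
      (HahnSeries.C (insertVar n i s) : LaurentSeries (IterScalar n)) := by
  simp only [insertVar, Fin.lastCases_castSucc]
  rfl

theorem insertVar_C (n : ℕ) (i : Fin n) (c : ℂ) :
    insertVar n i (PowerSeries.C c) = algebraMap ℂ (IterScalar n) c := by
  induction n with
  | zero => exact i.elim0
  | succ n ih =>
    have h : algebraMap ℂ (IterScalar (n + 1)) c =
      (HahnSeries.C (algebraMap ℂ (IterScalar n) c) : LaurentSeries (IterScalar n)) := rfl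
    induction i using Fin.lastCases with
    | last => rw [insertVar_last, PowerSeries.map_C, HahnSeries.ofPowerSeries_C, h]
    | cast i => rw [insertVar_castSucc, ih, h]

theorem insertVar_coe (n : ℕ) (i : Fin n) (p : ℂ[X]) :
    insertVar n i (p : PowerSeries ℂ) = Polynomial.aeval (insertVar n i PowerSeries.X) p := by
  induction p using Polynomial.induction_on' with
  | add p q hp hq => rw [Polynomial.coe_add, map_add, map_add, hp, hq]
  | monomial k c =>
    rw [← Polynomial.C_mul_X_pow_eq_monomial, Polynomial.coe_mul, Polynomial.coe_pow,
      Polynomial.coe_C, Polynomial.coe_X, map_mul, map_pow, insertVar_C, map_mul, map_pow,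
      Polynomial.aeval_X, Polynomial.aeval_C]

theorem insertVar_X_injective (n : ℕ) :
    Function.Injective fun i : Fin n => insertVar n i PowerSeries.X := by
  induction n with
  | zero => exact fun i => i.elim0
  | succ n ih =>
    have := (isField_iterScalar n).nontrivial
    -- `xₙ₊₁` is not constant as a series in `xₙ₊₁`, whereas `x₁, …, xₙ` are.
    have hne : ∀ i : Fin n, insertVar (n + 1) (Fin.last n) PowerSeries.X ≠
        insertVar (n + 1) i.castSucc PowerSeries.X := by
      intro i h
      rw [insertVar_last, insertVar_castSucc, PowerSeries.map_X, HahnSeries.ofPowerSeries_X] at h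
      have h1 := congrArg (fun s : LaurentSeries (IterScalar n) => s.coeff 1) h
      simp [HahnSeries.coeff_single_of_ne] at h1
    intro i j h
    induction i using Fin.lastCases with
    | last =>
      induction j using Fin.lastCases with
      | last => rfl
      | cast j => exact absurd h (hne j)
    | cast i =>
      induction j using Fin.lastCases with
      | last => exact absurd h.symm (hne i)
      | cast j =>
        simp only [insertVar_castSucc] at h
        rw [ih (HahnSeries.C_injective h)]

/-- The `R((x))`-linear map `M((x)) → R((x))` that applies an `R`-linear map `M → R` to the
coefficients. -/
def hahnMap {R M : Type*} [CommRing R] [AddCommGroup M] [Module R M] (g : M →ₗ[R] R) :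
    HahnModule ℤ R M →ₗ[LaurentSeries R] LaurentSeries R where
  toFun y := ((HahnModule.of R).symm y).map g
  map_add' x y := by ext k; simp
  map_smul' x y := by
    ext k
    rw [RingHom.id_apply, smul_eq_mul, 
      HahnSeries.coeff_mul_right' (s := ((HahnModule.of R).symm y).support)
      ((HahnModule.of R).symm y).isPWO_support]
    · rw [HahnSeries.map_coeff, HahnModule.coeff_smul, map_sum]
      refine Finset.sum_congr ?_ fun ij _ => by simp
      ext ij
      simp
    · intro k hk hz
      apply hk
      simp [hz]

variable {V : Type u} [AddCommGroup V] [Module ℂ V]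

/-- The `ℂ((x₁))⋯((xₙ))`-linear map `V((x₁))⋯((xₙ)) → ℂ((x₁))⋯((xₙ))` that applies a linear
functional of `V` to all coefficients. -/
def coeffMap (φ : V →ₗ[ℂ] ℂ) : (n : ℕ) → (IterLaurent V n →ₗ[IterScalar n] IterScalar n)
  | 0 => φ
  | n + 1 => hahnMap (coeffMap φ n)

theorem coeffMap_succ_coeff (φ : V →ₗ[ℂ] ℂ) (n : ℕ) (x : IterLaurent V (n + 1)) (k : ℤ) :
    HahnSeries.coeff (Γ := ℤ) (R := IterScalar n) (coeffMap φ (n + 1) x) k =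
      coeffMap φ n (((IterLaurent.ofSeries n).symm x).coeff k) := rfl

/-! ### Multiplicative families of functionals and products of vertex operators -/

section Associative

variable {A : Type u} [Ring A] [Algebra ℂ A]

/-- The power series `φ(e^{x D} a) ∈ ℂ[[x]]`. -/
def expSeries (D : A →ₗ[ℂ] A) (φ : A →ₗ[ℂ] ℂ) (a : A) : PowerSeries ℂ :=
  PowerSeries.mk fun j => φ ((j.factorial : ℂ)⁻¹ • (D ^ j) a)

variable {D : A →ₗ[ℂ] A} {P : Submodule ℂ A} {F : ℕ → A →ₗ[ℂ] ℂ}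

theorem derivation_pow_mem (hD : ∀ a b, D (a * b) = D a * b + a * D b) (hDP : ∀ a ∈ P, D a ∈ P)
    {k : ℕ} {a : A} (ha : a ∈ P ^ k) (j : ℕ) : (D ^ j) a ∈ P ^ k := by
  have h1 : ∀ (k : ℕ) (a : A), a ∈ P ^ k → D a ∈ P ^ k := by
    intro k
    induction k with
    | zero =>
      intro a ha
      rw [pow_zero] at ha ⊢
      obtain ⟨c, rfl⟩ := Submodule.mem_one.1 ha
      have h : D 1 = 0 := by simpa using hD 1 1
      rw [Algebra.algebraMap_eq_smul_one, map_smul, h, smul_zero]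
      exact Submodule.zero_mem _
    | succ k ih =>
      intro a ha
      rw [pow_succ] at ha ⊢
      induction ha using Submodule.mul_induction_on' with
      | mem_mul_mem m hm n hn =>
        rw [hD]
        exact Submodule.add_mem _ (Submodule.mul_mem_mul (ih m hm) hn)
          (Submodule.mul_mem_mul hm (hDP n hn))
      | add x _ y _ hx hy => rw [map_add]; exact Submodule.add_mem _ hx hy
  induction j with
  | zero => exact ha
  | succ j ih => rw [pow_succ']; exact h1 _ _ ih

theorem expSeries_mul (hD : ∀ a b, D (a * b) = D a * b + a * D b) (hDP : ∀ a ∈ P, D a ∈ P)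
    (hF : ∀ k l, ∀ a ∈ P ^ k, ∀ b ∈ P ^ l, F (k + l) (a * b) = F k a * F l b)
    {k l : ℕ} {a b : A} (ha : a ∈ P ^ k) (hb : b ∈ P ^ l) :
    expSeries D (F (k + l)) (a * b) = expSeries D (F k) a * expSeries D (F l) b := by
  ext m
  rw [PowerSeries.coeff_mul]
  simp only [expSeries, PowerSeries.coeff_mk]
  rw [leibniz_pow hD, Finset.smul_sum, map_sum]
  refine Finset.sum_congr rfl fun ij hij => ?_
  rw [← Finset.HasAntidiagonal.mem_antidiagonal.1 hij, map_smul, map_nsmul,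
    hF k l _ (derivation_pow_mem hD hDP ha _) _ (derivation_pow_mem hD hDP hb _), map_smul,
    map_smul, smul_eq_mul, smul_eq_mul, smul_eq_mul, nsmul_eq_mul,
    ← Nat.add_choose_mul_factorial_mul_factorial ij.1 ij.2]
  have c1 : ((ij.1 + ij.2).choose ij.2 : ℂ) ≠ 0 := by
    exact_mod_cast (Nat.choose_pos (Nat.le_add_left _ _)).ne'
  have f1 : ∀ k : ℕ, (k.factorial : ℂ) ≠ 0 := fun k => by exact_mod_cast k.factorial_ne_zero
  have f2 := f1 ij.1
  have f3 := f1 ij.2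
  rw [Nat.choose_symm_add]
  push_cast
  field_simp

theorem expSeries_list_prod (hD : ∀ a b, D (a * b) = D a * b + a * D b) (hDP : ∀ a ∈ P, D a ∈ P)
    (hF : ∀ k l, ∀ a ∈ P ^ k, ∀ b ∈ P ^ l, F (k + l) (a * b) = F k a * F l b)
    (hF1 : F 0 1 = 1) (s : List A) (hs : ∀ a ∈ s, a ∈ P) :
    expSeries D (F s.length) s.prod = (s.map (expSeries D (F 1))).prod := by
  have hmem : ∀ s : List A, (∀ a ∈ s, a ∈ P) → s.prod ∈ P ^ s.length := fun s => by
    induction s with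
    | nil => exact fun _ => Submodule.one_le.1 (pow_zero P).ge
    | cons a s ih =>
      intro hs
      rw [List.prod_cons, List.length_cons, pow_succ']
      exact Submodule.mul_mem_mul (hs a List.mem_cons_self)
        (ih fun b hb => hs b (List.mem_cons_of_mem _ hb))
  induction s with
  | nil =>
    have h : D 1 = 0 := by simpa using hD 1 1
    ext m
    rcases m with _ | m
    · simp [expSeries, hF1]
    · simp [expSeries, PowerSeries.coeff_one, pow_succ, h]
  | cons a s ih =>
    rw [List.prod_cons, List.length_cons, add_comm, expSeries_mul hD hDP hF (k := 1)
      (by rw [pow_one]; exact hs a List.mem_cons_self)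
      (hmem s fun b hb => hs b (List.mem_cons_of_mem _ hb)),
      ih fun b hb => hs b (List.mem_cons_of_mem _ hb), List.map_cons, List.prod_cons]

theorem coeff_ofDerivation_Y (hD : ∀ a b, D (a * b) = D a * b + a * D b) (a b : A) (k : ℤ) :
    (((ofDerivation D hD).Y a)[[-k - 1]]) b = expMode D a k b := by
  change expMode D a (-(-k - 1) - 1) b = _
  congr 1
  congr 1
  ring

theorem coeff_C_mul_mul_C {R : Type*} [CommRing R] (c d : R) (s : LaurentSeries R) (j : ℤ) :
    (HahnSeries.C c * s * HahnSeries.C d : LaurentSeries R).coeff j = c * s.coeff j * d := by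
  rw [mul_assoc, HahnSeries.C_mul_eq_smul, mul_comm s, HahnSeries.C_mul_eq_smul,
    HahnSeries.coeff_smul, HahnSeries.coeff_smul, smul_eq_mul, smul_eq_mul, mul_comm d, mul_assoc]

/-- The leading term of a product of vertex operators: if the functionals `F k` are multiplicative
on the filtration by the powers of `P`, the coefficients of `Y(u₁, x₁) ⋯ Y(uₙ, xₙ) w` are mapped by
`F` of the total degree to the product of the series `F(e^{xᵢ D} uᵢ)` and `F(w)`. -/
theorem coeffMap_iterY (hD : ∀ a b, D (a * b) = D a * b + a * D b) (hDP : ∀ a ∈ P, D a ∈ P)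
    (hF : ∀ k l, ∀ a ∈ P ^ k, ∀ b ∈ P ^ l, F (k + l) (a * b) = F k a * F l b)
    (n : ℕ) (k : Fin n → ℕ) (u : Fin n → A) (hu : ∀ i, u i ∈ P ^ k i) (l : ℕ) (w : A)
    (hw : w ∈ P ^ l) :
    coeffMap (F (∑ i, k i + l)) n ((ofDerivation D hD).iterY n u w) =
      (∏ i, insertVar n i (expSeries D (F (k i)) (u i))) * algebraMap ℂ (IterScalar n) (F l w) := by
  induction n generalizing l w with
  | zero =>
    simp only [Finset.univ_eq_empty, Finset.sum_empty, Finset.prod_empty, one_mul, zero_add]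
    rfl
  | succ n ih =>
    rw [Fin.sum_univ_castSucc, Fin.prod_univ_castSucc]
    simp only [insertVar_castSucc]
    have e1 : (∏ i : Fin n, (HahnSeries.C
        (insertVar n i (expSeries D (F (k i.castSucc)) (u i.castSucc))) :
          LaurentSeries (IterScalar n))) = HahnSeries.C
        (∏ i : Fin n, insertVar n i (expSeries D (F (k i.castSucc)) (u i.castSucc))) :=
      (map_prod _ _ _).symm
    have e2 : algebraMap ℂ (IterScalar (n + 1)) (F l w) =
      (HahnSeries.C (algebraMap ℂ (IterScalar n) (F l w)) : LaurentSeries (IterScalar n)) := rfl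
    rw [insertVar_last, e2]
    refine Eq.trans ?_ (congrArg (fun c : LaurentSeries (IterScalar n) => c * _ * _) e1.symm)
    refine HahnSeries.ext (funext fun j => ?_)
    rw [coeffMap_succ_coeff, NonlocalVertexAlgebra.iterY_coeff, coeff_ofDerivation_Y]
    refine Eq.trans ?_ (coeff_C_mul_mul_C _ _ _ j).symm
    rcases j with j | j
    · have h := derivation_pow_mem hD hDP (hu (Fin.last n)) j
      have h2 : expMode D (u (Fin.last n)) (Int.ofNat j) w =
        ((j.factorial : ℂ)⁻¹ • (D ^ j) (u (Fin.last n))) * w := rfl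
      rw [h2, add_assoc, ih (fun i => k i.castSucc) (Fin.init u) (fun i => hu i.castSucc) _ _
        (by rw [pow_add]; exact Submodule.mul_mem_mul (Submodule.smul_mem _ _ h) hw),
        hF _ _ _ (Submodule.smul_mem _ _ h) _ hw, map_mul]
      rw [Int.ofNat_eq_natCast, HahnSeries.ofPowerSeries_apply_coeff, PowerSeries.coeff_map,
        expSeries, PowerSeries.coeff_mk, mul_assoc]
      rfl
    · have h2 : expMode D (u (Fin.last n)) (Int.negSucc j) w = 0 := rfl
      rw [h2, map_zero, map_zero, HahnSeries.ofPowerSeries_apply,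
        HahnSeries.embDomain_of_notMem_range, mul_zero, zero_mul]
      simp

end Associative

/-! ### Leading symbols on the enveloping algebra -/

attribute [local instance 100] LieRing.ofAssociativeRing

open UniversalEnvelopingAlgebra (ι)

section Filtration

variable (L : Type u) [LieRing L] [LieAlgebra ℂ L]

/-- The subspace `ℂ + L` of `U(L)`; its `k`-th power is the `k`-th step of the standard
filtration. -/
def degreeLEOne : Submodule ℂ (UniversalEnvelopingAlgebra ℂ L) :=
  1 ⊔ LinearMap.range (ι ℂ : L →ₗ⁅ℂ⁆ UniversalEnvelopingAlgebra ℂ L).toLinearMap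

theorem one_le_degreeLEOne : 1 ≤ degreeLEOne L := le_sup_left

variable {L}

theorem ι_mem_degreeLEOne (a : L) : ι ℂ a ∈ degreeLEOne L :=
  Submodule.mem_sup_right ⟨a, rfl⟩

theorem mem_degreeLEOne {p : UniversalEnvelopingAlgebra ℂ L} (hp : p ∈ degreeLEOne L) :
    ∃ (c : ℂ) (a : L), p = c • 1 + ι ℂ a := by
  obtain ⟨y, hy, z, ⟨a, rfl⟩, rfl⟩ := Submodule.mem_sup.1 hp
  obtain ⟨c, rfl⟩ := Submodule.mem_one.1 hy
  exact ⟨c, a, by rw [Algebra.algebraMap_eq_smul_one]; rfl⟩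

theorem envDeriv_mem_degreeLEOne (d : LieDerivation ℂ L L) {p : UniversalEnvelopingAlgebra ℂ L}
    (hp : p ∈ degreeLEOne L) : envDeriv d p ∈ degreeLEOne L := by
  obtain ⟨c, a, rfl⟩ := mem_degreeLEOne hp
  have h : envDeriv d 1 = 0 := by simpa using envDeriv_mul d 1 1
  rw [map_add, map_smul, h, smul_zero, zero_add, envDeriv_ι]
  exact ι_mem_degreeLEOne _

end Filtration

section Action

variable {L : Type u} [LieRing L] [LieAlgebra ℂ L] {R : Type*} [CommRing R] [Algebra ℂ R]

/-- If `U(L)` acts on `R` by differential operators, `ev` is a point of `R` and `f` is a function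
that vanishes there, this is the functional `u ↦ (u fᵏ)(ev) / k!` of `U(L)`. For `u` of degree at
most `k` it is the value of the symbol of `u` at the covector `df`. -/
def leadingFunctional (ρ : UniversalEnvelopingAlgebra ℂ L →ₐ[ℂ] Module.End ℂ R) (ev : R →ₐ[ℂ] ℂ)
    (f : R) (k : ℕ) : UniversalEnvelopingAlgebra ℂ L →ₗ[ℂ] ℂ :=
  (k.factorial : ℂ)⁻¹ • (ev.toLinearMap ∘ₗ LinearMap.applyₗ (f ^ k) ∘ₗ ρ.toLinearMap)

variable {ρ : UniversalEnvelopingAlgebra ℂ L →ₐ[ℂ] Module.End ℂ R} {ev : R →ₐ[ℂ] ℂ} {f : R}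

theorem leadingFunctional_apply (k : ℕ) (u : UniversalEnvelopingAlgebra ℂ L) :
    leadingFunctional ρ ev f k u = (k.factorial : ℂ)⁻¹ * ev (ρ u (f ^ k)) := rfl

theorem ev_apply_pow_succ_mul (hf : ev f = 0)
    (hρ : ∀ (a : L) (g h : R), ρ (ι ℂ a) (g * h) = ρ (ι ℂ a) g * h + g * ρ (ι ℂ a) h)
    {k : ℕ} {u p : UniversalEnvelopingAlgebra ℂ L}
    (hu : ∀ g, ev (ρ u (f ^ k * g)) = ev (ρ u (f ^ k)) * ev g) (hp : p ∈ degreeLEOne L) (g : R) :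
    ev (ρ (u * p) (f ^ (k + 1) * g)) = (k + 1) * ev (ρ u (f ^ k)) * ev (ρ p f) * ev g := by
  obtain ⟨c, a, rfl⟩ := mem_degreeLEOne hp
  have hpow : ∀ k : ℕ, ρ (ι ℂ a) (f ^ (k + 1)) = (k + 1) * f ^ k * ρ (ι ℂ a) f := by
    intro k
    induction k with
    | zero => simp
    | succ k ih =>
      rw [pow_succ, hρ, ih]
      push_cast
      ring
  have h1 : ρ (c • 1 + ι ℂ a) (f ^ (k + 1) * g) =
      f ^ k * (c • (f * g) + ((k + 1) * ρ (ι ℂ a) f * g + f * ρ (ι ℂ a) g)) := by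
    rw [map_add, map_smul, map_one, LinearMap.add_apply, LinearMap.smul_apply, Module.End.one_apply,
      hρ, hpow, Algebra.smul_def, Algebra.smul_def]
    ring
  rw [map_mul ρ, Module.End.mul_apply, h1, hu]
  simp only [map_add, map_smul, map_mul, map_one, hf, map_natCast, LinearMap.add_apply,
    LinearMap.smul_apply, Module.End.one_apply, zero_mul, smul_zero, zero_add, add_zero]
  ring

/-- An operator of order at most `k` applied to `fᵏ g`, where `f` vanishes at the point `ev`,
depends at this point only on the value of `g`. -/
theorem ev_apply_pow_mul (hf : ev f = 0)
    (hρ : ∀ (a : L) (g h : R), ρ (ι ℂ a) (g * h) = ρ (ι ℂ a) g * h + g * ρ (ι ℂ a) h)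
    {k : ℕ} {u : UniversalEnvelopingAlgebra ℂ L} (hu : u ∈ degreeLEOne L ^ k) (g : R) :
    ev (ρ u (f ^ k * g)) = ev (ρ u (f ^ k)) * ev g := by
  induction k generalizing u g with
  | zero =>
    rw [pow_zero] at hu
    obtain ⟨c, rfl⟩ := Submodule.mem_one.1 hu
    simp [Algebra.algebraMap_eq_smul_one]
  | succ k ih =>
    rw [pow_succ] at hu
    induction hu using Submodule.mul_induction_on' with
    | mem_mul_mem u hu p hp =>
      have h := ev_apply_pow_succ_mul hf hρ (ih hu) hp 1
      rw [mul_one, map_one, mul_one] at h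
      rw [ev_apply_pow_succ_mul hf hρ (ih hu) hp, h]
    | add x _ y _ hx hy => simp only [map_add, LinearMap.add_apply, hx, hy, add_mul]

/-- Multiplicativity of symbols. -/
theorem leadingFunctional_mul (hf : ev f = 0)
    (hρ : ∀ (a : L) (g h : R), ρ (ι ℂ a) (g * h) = ρ (ι ℂ a) g * h + g * ρ (ι ℂ a) h)
    (k l : ℕ) (u : UniversalEnvelopingAlgebra ℂ L) (hu : u ∈ degreeLEOne L ^ k)
    (v : UniversalEnvelopingAlgebra ℂ L) (hv : v ∈ degreeLEOne L ^ l) :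
    leadingFunctional ρ ev f (k + l) (u * v) =
      leadingFunctional ρ ev f k u * leadingFunctional ρ ev f l v := by
  have hstep : ∀ k, ∀ u ∈ degreeLEOne L ^ k, ∀ p ∈ degreeLEOne L,
      leadingFunctional ρ ev f (k + 1) (u * p) = leadingFunctional ρ ev f k u * ev (ρ p f) := by
    intro k u hu p hp
    have h := ev_apply_pow_succ_mul hf hρ (ev_apply_pow_mul hf hρ hu) hp 1
    rw [mul_one, map_one, mul_one] at h
    rw [leadingFunctional_apply, leadingFunctional_apply, h, Nat.factorial_succ]
    have f1 : (k.factorial : ℂ) ≠ 0 := by exact_mod_cast k.factorial_ne_zero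
    have f2 : (k + 1 : ℂ) ≠ 0 := by exact_mod_cast k.succ_ne_zero
    push_cast
    field_simp
  induction l generalizing v with
  | zero =>
    rw [pow_zero] at hv
    obtain ⟨c, rfl⟩ := Submodule.mem_one.1 hv
    simp [Algebra.algebraMap_eq_smul_one, leadingFunctional_apply, mul_comm]
  | succ l ih =>
    rw [pow_succ] at hv
    induction hv using Submodule.mul_induction_on' with
    | mem_mul_mem v hv p hp =>
      rw [← mul_assoc, ← add_assoc,
        hstep _ _ (by rw [pow_add]; exact Submodule.mul_mem_mul hu hv) _ hp, ih v hv,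
        hstep _ _ hv _ hp, mul_assoc]
    | add x _ y _ hx hy => rw [mul_add, map_add, map_add, hx, hy, mul_add]

end Action

section Derivations

variable {L : Type u} [LieRing L] [LieAlgebra ℂ L] {M β : Type*} [AddCommGroup M] [Module ℂ M]

/-- The derivation of the symmetric algebra of a vector space `M` with basis `B`, realized as a
polynomial algebra, that extends a linear endomorphism of `M`. -/
def symDerivation (B : Module.Basis β ℂ M) (T : Module.End ℂ M) :
    Derivation ℂ (MvPolynomial β ℂ) (MvPolynomial β ℂ) :=
  MvPolynomial.mkDerivation ℂ fun i => B.constr ℂ MvPolynomial.X (T (B i))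

theorem symDerivation_constr (B : Module.Basis β ℂ M) (T : Module.End ℂ M) (m : M) :
    symDerivation B T (B.constr ℂ MvPolynomial.X m) = B.constr ℂ MvPolynomial.X (T m) := by
  refine LinearMap.congr_fun (f := (symDerivation B T).toLinearMap ∘ₗ
    B.constr ℂ MvPolynomial.X) (g := B.constr ℂ MvPolynomial.X ∘ₗ T) (B.ext fun i => ?_) m
  simp [symDerivation, MvPolynomial.mkDerivation_X]

/-- A representation of `L` on `M`, extended to an action by derivations on the symmetric algebra of
`M`. -/
def symAction (B : Module.Basis β ℂ M) (ρ : L →ₗ⁅ℂ⁆ Module.End ℂ M) :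
    L →ₗ⁅ℂ⁆ Derivation ℂ (MvPolynomial β ℂ) (MvPolynomial β ℂ) where
  toFun a := symDerivation B (ρ a)
  map_add' a b := MvPolynomial.derivation_ext fun i => by simp [symDerivation]
  map_smul' c a := MvPolynomial.derivation_ext fun i => by simp [symDerivation]
  map_lie' {a b} := MvPolynomial.derivation_ext fun i => by
    have hX : (MvPolynomial.X i : MvPolynomial β ℂ) = B.constr ℂ MvPolynomial.X (B i) := by simp
    rw [Derivation.commutator_apply, hX]
    simp only [symDerivation_constr]
    rw [LieHom.map_lie, LieRing.of_associative_ring_bracket, LinearMap.sub_apply, map_sub,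
      Module.End.mul_apply, Module.End.mul_apply]

/-- The restriction to `L` of the adjoint representation of `L ⋊ ℂ d`, where `(b, c)` stands for
`b - c d`: `a` acts by `(b, c) ↦ ([a, b] + c d(a), 0)`. -/
def affineRep (d : LieDerivation ℂ L L) : L →ₗ⁅ℂ⁆ Module.End ℂ (L × ℂ) where
  toFun a := LinearMap.inl ℂ L ℂ ∘ₗ
    (LinearMap.coprod (LieAlgebra.ad ℂ L a) (LinearMap.toSpanSingleton ℂ L (d a)))
  map_add' a b := by ext <;> simp
  map_smul' c a := by ext <;> simp
  map_lie' {a b} := by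
    ext <;> simp [LieRing.of_associative_ring_bracket]

/-- The functional `F k` extends, up to lower order terms, the `k`-th power of the linear form
`a ↦ μ (d a)` of `L` to `U(L)`. -/
theorem exists_leadingFunctional (d : LieDerivation ℂ L L) (μ : L →ₗ[ℂ] ℂ) :
    ∃ F : ℕ → UniversalEnvelopingAlgebra ℂ L →ₗ[ℂ] ℂ,
      (∀ k l, ∀ u ∈ degreeLEOne L ^ k, ∀ v ∈ degreeLEOne L ^ l,
        F (k + l) (u * v) = F k u * F l v) ∧
      F 0 1 = 1 ∧ F 1 1 = 0 ∧ ∀ a : L, F 1 (ι ℂ a) = μ (d a) := by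
  -- The point `ev` is the linear form `(b, c) ↦ μ b` on `L × ℂ`; the function that vanishes there
  -- is the vector `(0, 1)`, on which `a` acts as `(0, 1) ↦ (d a, 0)`.
  let B := Module.Basis.ofVectorSpace ℂ (L × ℂ)
  let I := Module.Basis.ofVectorSpaceIndex ℂ (L × ℂ)
  let lin : L × ℂ →ₗ[ℂ] MvPolynomial I ℂ := B.constr ℂ MvPolynomial.X
  let ρ := UniversalEnvelopingAlgebra.lift ℂ
    ((LieModule.toEnd ℂ (Derivation ℂ (MvPolynomial I ℂ) (MvPolynomial I ℂ))
      (MvPolynomial I ℂ)).comp (symAction B (affineRep d)))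
  let ν : L × ℂ →ₗ[ℂ] ℂ := μ ∘ₗ LinearMap.fst ℂ L ℂ
  let ev : MvPolynomial I ℂ →ₐ[ℂ] ℂ := MvPolynomial.aeval fun i => ν (B i)
  have hρ : ∀ a g, ρ (ι ℂ a) g = symAction B (affineRep d) a g := by
    intro a g
    simp only [ρ, UniversalEnvelopingAlgebra.lift_ι_apply]
    rfl
  have hev : ∀ m, ev (lin m) = ν m := by
    intro m
    refine LinearMap.congr_fun (f := ev.toLinearMap ∘ₗ lin) (g := ν) (B.ext fun i => ?_) m
    simp [ev, lin]
  have hf : ev (lin (0, 1)) = 0 := by simp [hev, ν]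
  refine ⟨leadingFunctional ρ ev (lin (0, 1)), leadingFunctional_mul hf fun a g h => ?_, ?_, ?_,
    fun a => ?_⟩
  · rw [hρ, hρ, hρ, Derivation.leibniz, smul_eq_mul, smul_eq_mul]
    ring
  · simp [leadingFunctional_apply]
  · simp [leadingFunctional_apply, hf]
  · have h : symAction B (affineRep d) a (lin (0, 1)) = lin (affineRep d a (0, 1)) :=
      symDerivation_constr B _ _
    rw [leadingFunctional_apply, pow_one, hρ, h, hev]
    simp [ν, affineRep]

end Derivations

/-! ### Monomials span the enveloping algebra -/

section Spanning

variable {L : Type u} [LieRing L] [LieAlgebra ℂ L] {α : Type*}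

theorem list_prod_mem_degreeLEOne_pow (e : α → L) (s : List α) :
    (s.map fun i => ι ℂ (e i)).prod ∈ degreeLEOne L ^ s.length := by
  induction s with
  | nil => exact Submodule.one_le.1 (pow_zero (degreeLEOne L)).ge
  | cons a s ih =>
    rw [List.map_cons, List.prod_cons, List.length_cons, pow_succ']
    exact Submodule.mul_mem_mul (ι_mem_degreeLEOne _) ih

/-- Permuting the factors of a product changes it by terms of lower degree. -/
theorem list_prod_sub_mem_of_perm (e : α → L) {s t : List α} (h : s.Perm t) (k : ℕ)
    (hk : s.length ≤ k + 1) :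
    (s.map fun i => ι ℂ (e i)).prod - (t.map fun i => ι ℂ (e i)).prod ∈ degreeLEOne L ^ k := by
  induction h generalizing k with
  | nil => simp
  | @cons a s t h ih =>
    rw [List.map_cons, List.map_cons, List.prod_cons, List.prod_cons, ← mul_sub]
    rcases k with _ | k
    · have hs : s = [] := List.eq_nil_of_length_eq_zero (by simpa using hk)
      subst hs
      rw [h.nil_eq, sub_self, mul_zero]
      exact Submodule.zero_mem _
    · rw [pow_succ']
      exact Submodule.mul_mem_mul (ι_mem_degreeLEOne _) (ih k (by simpa using hk))
  | swap a b s =>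
    obtain ⟨k, rfl⟩ : ∃ l, k = l + 1 := ⟨k - 1, by simp at hk; lia⟩
    have h : (((b :: a :: s).map fun i => ι ℂ (e i)).prod -
        ((a :: b :: s).map fun i => ι ℂ (e i)).prod) =
        ι ℂ ⁅e b, e a⁆ * (s.map fun i => ι ℂ (e i)).prod := by
      simp only [List.map_cons, List.prod_cons, LieHom.map_lie,
        LieRing.of_associative_ring_bracket, sub_mul, mul_assoc]
    rw [h, pow_succ']
    refine Submodule.mul_mem_mul (ι_mem_degreeLEOne _) ?_
    exact pow_le_pow_right' (one_le_degreeLEOne L) (by simpa using hk)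
      (list_prod_mem_degreeLEOne_pow e s)
  | @trans s t r h₁ h₂ ih₁ ih₂ =>
    rw [← sub_add_sub_cancel]
    exact Submodule.add_mem _ (ih₁ k hk) (ih₂ k (h₁.length_eq ▸ hk))

/-- The factors of a monomial with exponent `s`, in some order. -/
def monoList (s : α →₀ ℕ) : List α := (Finsupp.toMultiset s).toList

theorem length_monoList (s : α →₀ ℕ) : (monoList s).length = s.degree := by
  rw [monoList, Multiset.length_toList, Finsupp.card_toMultiset]
  rfl

/-- A monomial in `U(L)`: the product of the elements `e i`, each taken `s i` times, in some
order. -/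
def mono (e : α → L) (s : α →₀ ℕ) : UniversalEnvelopingAlgebra ℂ L :=
  ((monoList s).map fun i => ι ℂ (e i)).prod

theorem mono_mem (e : α → L) (s : α →₀ ℕ) : mono e s ∈ degreeLEOne L ^ s.degree := by
  rw [← length_monoList]
  exact list_prod_mem_degreeLEOne_pow e _

/-- The order of the factors in a monomial does not matter for spanning: changing it introduces only
terms of lower degree. -/
theorem degreeLEOne_pow_le_span_mono (e : Module.Basis α ℂ L) (k : ℕ) :
    degreeLEOne L ^ k ≤ Submodule.span ℂ (mono e '' {s | s.degree ≤ k}) := by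
  classical
  have hmono : ∀ {k l : ℕ}, k ≤ l → Submodule.span ℂ (mono e '' {s | s.degree ≤ k}) ≤
      Submodule.span ℂ (mono e '' {s | s.degree ≤ l}) := fun hkl =>
    Submodule.span_mono (Set.image_mono fun s (hs : s.degree ≤ _) => hs.trans hkl)
  induction k with
  | zero =>
    rw [pow_zero, Submodule.one_le]
    exact Submodule.subset_span ⟨0, by simp, by simp [mono, monoList]⟩
  | succ k ih =>
    rw [pow_succ', Submodule.mul_le]
    intro p hp u hu
    obtain ⟨c, a, rfl⟩ := mem_degreeLEOne hp
    rw [add_mul, smul_mul_assoc, one_mul]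
    refine Submodule.add_mem _ (Submodule.smul_mem _ _ (hmono k.le_succ (ih hu))) ?_
    have hu' := ih hu
    clear hu
    induction hu' using Submodule.span_induction with
    | zero => rw [mul_zero]; exact Submodule.zero_mem _
    | add x y _ _ hx hy => rw [mul_add]; exact Submodule.add_mem _ hx hy
    | smul c x _ hx => rw [mul_smul_comm]; exact Submodule.smul_mem _ _ hx
    | mem x hx =>
      obtain ⟨s, hs, rfl⟩ := hx
      have ha := e.mem_span a
      clear hp
      induction ha using Submodule.span_induction with
      | zero => simp
      | add x y _ _ hx hy => rw [map_add, add_mul]; exact Submodule.add_mem _ hx hy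
      | smul c x _ hx => rw [map_smul, smul_mul_assoc]; exact Submodule.smul_mem _ _ hx
      | mem x hx =>
        obtain ⟨i, rfl⟩ := hx
        have hperm : (i :: monoList s).Perm (monoList (Finsupp.single i 1 + s)) := by
          rw [← Multiset.coe_eq_coe, ← Multiset.cons_coe, monoList, monoList, Multiset.coe_toList,
            Multiset.coe_toList, map_add, Finsupp.toMultiset_single, one_smul,
            Multiset.singleton_add]
        have hlen : (i :: monoList s).length ≤ k + 1 := by
          rw [List.length_cons, length_monoList]
          exact Nat.succ_le_succ hs
        have h := list_prod_sub_mem_of_perm e hperm k hlen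
        rw [← sub_add_cancel (ι ℂ (e i) * mono e s) (mono e (Finsupp.single i 1 + s))]
        refine Submodule.add_mem _ (hmono k.le_succ (ih h)) (Submodule.subset_span ⟨_, ?_, rfl⟩)
        rw [Set.mem_ofPred_eq, ← length_monoList, ← hperm.length_eq]
        exact hlen

theorem span_range_mono (e : Module.Basis α ℂ L) :
    Submodule.span ℂ (Set.range (mono e)) = ⊤ := by
  rw [eq_top_iff]
  rintro u -
  have hu : ∃ k, u ∈ degreeLEOne L ^ k := by
    obtain ⟨t, rfl⟩ : ∃ t, UniversalEnvelopingAlgebra.mkAlgHom ℂ L t = u :=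
      RingCon.mkₐ_surjective (α := ℂ) (UniversalEnvelopingAlgebra.ringCon ℂ L) u
    have hmono : ∀ {k l : ℕ}, k ≤ l → degreeLEOne L ^ k ≤ degreeLEOne L ^ l := fun h =>
      pow_le_pow_right' (one_le_degreeLEOne L) h
    induction t using TensorAlgebra.induction with
    | algebraMap c =>
      refine ⟨0, ?_⟩
      rw [pow_zero, AlgHom.commutes]
      exact Submodule.algebraMap_mem c
    | ι a => exact ⟨1, by rw [pow_one]; exact ι_mem_degreeLEOne a⟩
    | mul s t hs ht =>
      obtain ⟨k, hk⟩ := hs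
      obtain ⟨l, hl⟩ := ht
      exact ⟨k + l, by rw [map_mul, pow_add]; exact Submodule.mul_mem_mul hk hl⟩
    | add s t hs ht =>
      obtain ⟨k, hk⟩ := hs
      obtain ⟨l, hl⟩ := ht
      exact ⟨max k l, by
        rw [map_add]
        exact Submodule.add_mem _ (hmono (le_max_left k l) hk) (hmono (le_max_right k l) hl)⟩
  obtain ⟨k, hk⟩ := hu
  exact Submodule.span_mono (Set.image_subset_range _ _) (degreeLEOne_pow_le_span_mono e k hk)

end Spanning

/-! ### Nondegeneracy -/

section Nondegenerate

variable {L : Type u} [LieRing L] [LieAlgebra ℂ L]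

theorem envDeriv_pow_ι (d : LieDerivation ℂ L L) (k : ℕ) (a : L) :
    (envDeriv d ^ k) (ι ℂ a) = ι ℂ ((d : L →ₗ[ℂ] L)^[k] a) := by
  induction k with
  | zero => rfl
  | succ k ih =>
    rw [pow_succ', Module.End.mul_apply, ih, envDeriv_ι, Function.iterate_succ_apply']
    rfl

/-- The series attached to a monomial is the product of the series attached to its factors. -/
theorem expSeries_mono {α : Type*} (d : LieDerivation ℂ L L)
    {F : ℕ → UniversalEnvelopingAlgebra ℂ L →ₗ[ℂ] ℂ}
    (hF : ∀ k l, ∀ u ∈ degreeLEOne L ^ k, ∀ v ∈ degreeLEOne L ^ l,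
      F (k + l) (u * v) = F k u * F l v) (hF1 : F 0 1 = 1) (e : α → L) (s : α →₀ ℕ) :
    expSeries (envDeriv d) (F s.degree) (mono e s) =
      s.prod fun i c => expSeries (envDeriv d) (F 1) (ι ℂ (e i)) ^ c := by
  have h := expSeries_list_prod (envDeriv_mul d) (fun a ha => envDeriv_mem_degreeLEOne d ha) hF hF1
    ((monoList s).map fun i => ι ℂ (e i)) (by
      intro a ha
      obtain ⟨i, -, rfl⟩ := List.mem_map.1 ha
      exact ι_mem_degreeLEOne _)
  rw [List.length_map, length_monoList] at h
  rw [mono, h, List.map_map, ← Multiset.prod_coe, ← Multiset.map_coe, monoList, Multiset.coe_toList,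
    Finsupp.toMultiset_map, Finsupp.prod_toMultiset, Finsupp.prod_mapDomain_index]
  · rfl
  · exact fun _ => pow_zero _
  · exact fun _ _ _ => pow_add _ _ _

theorem prod_prod_curry {κ α K : Type*} [Fintype κ] [CommMonoid K] (M : κ × α →₀ ℕ)
    (v : κ × α → K) :
    ∏ i, (M.curry i).prod (fun a c => v (i, a) ^ c) = M.prod fun t c => v t ^ c := by
  rw [← Finsupp.prod_fintype M.curry (fun i s => s.prod fun a c => v (i, a) ^ c) (fun i => rfl)]
  exact Finsupp.sum_curry_index (N := Additive K) M fun i a c => Additive.ofMul (v (i, a) ^ c)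

theorem sum_degree_curry {κ α : Type*} [Fintype κ] (M : κ × α →₀ ℕ) :
    ∑ i, (M.curry i).degree = M.degree := by
  rw [← Finsupp.sum_fintype M.curry (fun i s => s.degree) (fun i => map_zero _)]
  exact Finsupp.sum_curry_index M fun i a c => c

/-- The tensor product of the monomials of `U(L)` that correspond to the parts of the exponent
`M`. -/
def tensorMono {α : Type*} (e : α → L) (n : ℕ) (M : Fin n × α →₀ ℕ) :
    ⨂[ℂ] _ : Fin n, UniversalEnvelopingAlgebra ℂ L :=
  PiTensorProduct.tprod ℂ fun i => mono e (M.curry i)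

theorem span_range_tensorMono {α : Type*} (e : Module.Basis α ℂ L) (n : ℕ) :
    Submodule.span ℂ (Set.range (tensorMono e n)) = ⊤ := by
  rw [eq_top_iff, ← PiTensorProduct.span_tprod_eq_top, Submodule.span_le]
  rintro _ ⟨u, rfl⟩
  have hu : ∀ i, u i ∈ Submodule.span ℂ (Set.range (mono e)) := fun i => by
    rw [span_range_mono]; trivial
  choose c hc using fun i => Finsupp.mem_span_range_iff_exists_finsupp.1 (hu i)
  obtain rfl : (fun i => ∑ s ∈ (c i).support, c i s • mono e s) = u := funext hc
  rw [MultilinearMap.map_sum_finset]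
  refine Submodule.sum_mem _ fun r _ => ?_
  rw [MultilinearMap.map_smul_univ]
  refine Submodule.smul_mem _ _ (Submodule.subset_span
    ⟨(Finsupp.equivFunOnFinite.symm r).uncurry, ?_⟩)
  rw [tensorMono, Finsupp.curry_uncurry]
  rfl

theorem exists_eq_sum_tensorMono {α : Type*} (e : Module.Basis α ℂ L) (n : ℕ)
    (t : (⨂[ℂ] _ : Fin n, UniversalEnvelopingAlgebra ℂ L) ⊗[ℂ] (IterScalar n)) :
    ∃ f : MvPolynomial (Fin n × α) (IterScalar n),
      t = ∑ M ∈ f.support, tensorMono e n M ⊗ₜ[ℂ] f.coeff M := by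
  let Φ : ((Fin n × α →₀ ℕ) →₀ IterScalar n) →ₗ[ℂ]
      (⨂[ℂ] _ : Fin n, UniversalEnvelopingAlgebra ℂ L) ⊗[ℂ] (IterScalar n) :=
    Finsupp.lsum ℂ fun M => TensorProduct.mk ℂ _ _ (tensorMono e n M)
  have h : t ∈ LinearMap.range Φ := by
    induction t using TensorProduct.induction_on with
    | zero => exact Submodule.zero_mem _
    | add x y hx hy => exact Submodule.add_mem _ hx hy
    | tmul t k =>
      have ht : t ∈ Submodule.span ℂ (Set.range (tensorMono e n)) := by
        rw [span_range_tensorMono]; trivial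
      induction ht using Submodule.span_induction with
      | zero => rw [TensorProduct.zero_tmul]; exact Submodule.zero_mem _
      | add x y _ _ hx hy => rw [TensorProduct.add_tmul]; exact Submodule.add_mem _ hx hy
      | smul c x _ hx => rw [← TensorProduct.smul_tmul']; exact Submodule.smul_mem _ c hx
      | mem x hx =>
        obtain ⟨M, rfl⟩ := hx
        exact ⟨Finsupp.single M k, by simp [Φ]⟩
  obtain ⟨c, rfl⟩ := h
  exact ⟨AddMonoidAlgebra.ofCoeff c, rfl⟩

/-- The functional `F D` maps a product of vertex operators of monomials of total degree at most `D`
to its leading term. -/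
theorem coeffMap_iterY_tensorMono {α : Type*} (d : LieDerivation ℂ L L)
    {F : ℕ → UniversalEnvelopingAlgebra ℂ L →ₗ[ℂ] ℂ}
    (hF : ∀ k l, ∀ u ∈ degreeLEOne L ^ k, ∀ v ∈ degreeLEOne L ^ l,
      F (k + l) (u * v) = F k u * F l v) (hF1 : F 0 1 = 1) (hF2 : F 1 1 = 0) (e : α → L) (n : ℕ)
    (M : Fin n × α →₀ ℕ) {N : ℕ} (hM : M.degree ≤ N) :
    coeffMap (F N) n ((enveloping d).iterY n (fun i => mono e (M.curry i)) 1) =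
      if M.degree = N then
        M.prod fun t c => insertVar n t.1 (expSeries (envDeriv d) (F 1) (ι ℂ (e t.2))) ^ c
      else 0 := by
  obtain ⟨l, rfl⟩ := Nat.exists_eq_add_of_le hM
  have hone : ∀ l, (1 : UniversalEnvelopingAlgebra ℂ L) ∈ degreeLEOne L ^ l := fun l =>
    Submodule.one_le.1 (one_le_pow_of_one_le' (one_le_degreeLEOne L) l)
  have h := coeffMap_iterY (envDeriv_mul d) (fun a ha => envDeriv_mem_degreeLEOne d ha) hF n
    (fun i => (M.curry i).degree) (fun i => mono e (M.curry i)) (fun i => mono_mem e _) l 1 (hone l)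
  rw [sum_degree_curry] at h
  refine h.trans ?_
  simp only [expSeries_mono d hF hF1, Finsupp.prod, map_prod, map_pow]
  rcases l with _ | l
  · rw [hF1, map_one, mul_one, add_zero, if_pos rfl]
    exact prod_prod_curry M fun t => insertVar n t.1 (expSeries (envDeriv d) (F 1) (ι ℂ (e t.2)))
  · have h0 : F (l + 1) 1 = 0 := by
      simpa [hF2] using hF l 1 1 (hone l) 1 (hone 1)
    rw [h0, map_zero, mul_zero, if_neg (by lia)]

/-- If `Zₙ` kills `∑ f_M M`, where `M` runs over tensor products of monomials in the basis, then the
leading form of the polynomial `∑ f_M X^M` vanishes at the jets of all polynomials at `x₁, …, xₙ`,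
hence is zero. -/
theorem enveloping_nondegenerate_of_basis (d : LieDerivation ℂ L L) {J : Type*}
    (e : Module.Basis (J × ℕ) ℂ L) (he : ∀ j m, d (e (j, m)) = e (j, m + 1)) :
    (enveloping d).Nondegenerate := by
  classical
  intro n _
  rw [injective_iff_map_eq_zero]
  intro t ht
  obtain ⟨f, rfl⟩ := exists_eq_sum_tensorMono e n t
  have : CharZero (IterScalar n) :=
    have := (isField_iterScalar n).nontrivial
    charZero_of_injective_algebraMap (algebraMap ℂ (IterScalar n)).injective
  suffices hf : MvPolynomial.homogeneousComponent f.totalDegree f = 0 by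
    have h0 : f = 0 := by
      by_contra hne
      obtain ⟨M, hM, hdeg⟩ := Finset.exists_mem_eq_sup f.support
        (MvPolynomial.support_nonempty.2 hne) fun M => M.degree
      refine MvPolynomial.mem_support_iff.1 hM ?_
      have h := congrArg (MvPolynomial.coeff M) hf
      have hM' : M.degree = f.totalDegree := hdeg.symm
      rwa [MvPolynomial.coeff_homogeneousComponent, if_pos hM', MvPolynomial.coeff_zero] at h
    simp [h0]
  refine eq_zero_of_aeval_iterate_derivative_eq_zero (k := ℂ) (isField_iterScalar n)
    (insertVar_X_injective n) (MvPolynomial.homogeneousComponent f.totalDegree f) fun p => ?_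
  -- The linear form is chosen so that `F 1 (e^{xd} e (j, m))` is the `m`-th derivative of `p j`.
  -- Only its values at the basis vectors with `1 ≤ t.2` matter, as these span the range of `d`.
  obtain ⟨F, hF, hF1, hF2, hF3⟩ := exists_leadingFunctional d
    (e.constr ℂ fun t => (Polynomial.derivative^[t.2 - 1] (p t.1)).coeff 0)
  have hser : ∀ t : J × ℕ, expSeries (envDeriv d) (F 1) (ι ℂ (e t)) =
      ((Polynomial.derivative^[t.2] (p t.1) : ℂ[X]) : PowerSeries ℂ) := by
    rintro ⟨j, m⟩
    have hpow : ∀ k, (d : L →ₗ[ℂ] L)^[k] (e (j, m)) = e (j, k + m) := by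
      intro k
      induction k with
      | zero => rw [zero_add]; rfl
      | succ k ih => rw [Function.iterate_succ_apply', ih, add_right_comm]; exact he _ _
    ext k
    rw [expSeries, PowerSeries.coeff_mk, map_smul, envDeriv_pow_ι, hF3, hpow, he,
      Module.Basis.constr_basis, Polynomial.coeff_coe, Nat.add_sub_cancel,
      Function.iterate_add_apply, Polynomial.coeff_iterate_derivative, zero_add,
      Nat.descFactorial_self, nsmul_eq_mul, smul_eq_mul, inv_mul_cancel_left₀ (by exact_mod_cast k.factorial_ne_zero)]
  have h := congrArg (coeffMap (F f.totalDegree) n) ht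
  rw [map_zero, map_sum, map_sum] at h
  rw [MvPolynomial.homogeneousComponent_apply, map_sum, Finset.sum_filter]
  refine Eq.trans ?_ h
  refine Finset.sum_congr rfl fun M hM => ?_
  rw [tensorMono, NonlocalVertexAlgebra.Z_tmul, map_smul]
  refine Eq.trans ?_ (congrArg (fun z => f.coeff M • z)
    (coeffMap_iterY_tensorMono d hF hF1 hF2 e n M (MvPolynomial.le_totalDegree hM)).symm)
  split_ifs
  · rw [MvPolynomial.eval_monomial, smul_eq_mul]
    simp only [hser, insertVar_coe]
  · rw [smul_zero]

end Nondegenerate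

/-! ### Bases adapted to the derivation -/

/-- A basis over `ℂ[X]`, where `X` acts as `d`, gives the basis `d ^ m (b j)` over `ℂ`. -/
theorem exists_basis_of_basis_aeval {L : Type u} [AddCommGroup L] [Module ℂ L] (d : L →ₗ[ℂ] L)
    {I : Type*} (b : Module.Basis I ℂ[X] (Module.AEval' d)) :
    ∃ e : Module.Basis (I × ℕ) ℂ L, ∀ j m, d (e (j, m)) = e (j, m + 1) := by
  let e := ((Polynomial.basisMonomials ℂ).smulTower' b).map (Module.AEval'.of d).symm
  have he : ∀ j m, e (j, m) = (Module.AEval'.of d).symm ((Polynomial.X ^ m : ℂ[X]) • b j) := by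
    intro j m
    simp [e, Module.Basis.smulTower', Polynomial.X_pow_eq_monomial]
  refine ⟨e, fun j m => (Module.AEval'.of d).injective ?_⟩
  rw [← Module.AEval'.X_smul_of, he, he, LinearEquiv.apply_symm_apply, LinearEquiv.apply_symm_apply,
    smul_smul, pow_succ']

/-- The elements `(d/dt)ᵐ t⁻¹ ⊗ bⱼ` form a basis of `t⁻¹ ℂ[t⁻¹] ⊗ 𝔤` if the `bⱼ` form a basis of
`𝔤`. -/
theorem exists_basis_negCurrent (𝔤 : Type u) [LieRing 𝔤] [LieAlgebra ℂ 𝔤] :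
    ∃ (J : Type u) (e : Module.Basis (J × ℕ) ℂ (negCurrent 𝔤)),
      ∀ j m, negCurrentDeriv 𝔤 (e (j, m)) = e (j, m + 1) := by
  let b := Module.Basis.ofVectorSpace ℂ 𝔤
  let bT : Module.Basis ℤ ℂ ℂ[T;T⁻¹] := .ofRepr (AddMonoidAlgebra.coeffLinearEquiv ℂ)
  have hbT : ∀ n, bT n = LaurentPolynomial.T n := fun n => rfl
  -- `c m` is the scalar in `(d/dt)ᵐ t⁻¹ = c m • t⁻ᵐ⁻¹`.
  let c : ℕ → ℂˣ := fun m =>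
    (-1) ^ m * Units.mk0 (m.factorial : ℂ) (by exact_mod_cast m.factorial_ne_zero)
  have hc : ∀ m, (c m : ℂ) * ((-(m + 1 : ℤ) : ℤ) : ℂ) = c (m + 1) := by
    intro m
    simp only [c, Units.val_mul, Units.val_pow_eq_pow_val, Units.val_neg, Units.val_one,
      Units.val_mk0, Nat.factorial_succ]
    push_cast
    ring
  let v : Module.Basis.ofVectorSpaceIndex ℂ 𝔤 × ℕ → negCurrent 𝔤 := fun p =>
    ⟨(c p.2 : ℂ) • (LaurentPolynomial.T (-(p.2 + 1 : ℤ)) ⊗ₜ[ℂ] b p.1),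
      Submodule.smul_mem _ _ (Submodule.subset_span ⟨p.2, b p.1, rfl⟩)⟩
  have hli : LinearIndependent ℂ v := by
    refine LinearIndependent.of_comp (negCurrent 𝔤).toSubmodule.subtype ?_
    have h1 := (bT.tensorProduct b).linearIndependent.comp
      (fun p : Module.Basis.ofVectorSpaceIndex ℂ 𝔤 × ℕ => (-(p.2 + 1 : ℤ), p.1)) (by
        rintro ⟨i, m⟩ ⟨j, n⟩ h
        simp only [Prod.mk.injEq] at h
        ext
        · rw [h.2]
        · simp only
          lia)
    have h2 := h1.units_smul fun p => c p.2
    have h3 : (fun p : Module.Basis.ofVectorSpaceIndex ℂ 𝔤 × ℕ => c p.2) •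
        (⇑(bT.tensorProduct b) ∘ fun p : Module.Basis.ofVectorSpaceIndex ℂ 𝔤 × ℕ =>
          (-(p.2 + 1 : ℤ), p.1)) =
          fun p : Module.Basis.ofVectorSpaceIndex ℂ 𝔤 × ℕ => (c p.2 : ℂ) •
            ((LaurentPolynomial.T (-(p.2 + 1 : ℤ)) : ℂ[T;T⁻¹]) ⊗ₜ[ℂ] b p.1) := by
      funext p
      rw [Pi.smul_apply', Function.comp_apply, Module.Basis.tensorProduct_apply, hbT]
      rfl
    rw [h3] at h2
    exact h2
  have hsp : ⊤ ≤ Submodule.span ℂ (Set.range v) := by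
    rintro ⟨x, hx⟩ -
    have h : Submodule.span ℂ
        {z | ∃ (n : ℕ) (a : 𝔤), z = LaurentPolynomial.T (-(n + 1 : ℤ)) ⊗ₜ[ℂ] a} ≤
        (Submodule.span ℂ (Set.range v)).map (negCurrent 𝔤).toSubmodule.subtype := by
      rw [Submodule.span_le]
      rintro _ ⟨n, a, rfl⟩
      have ha := b.mem_span a
      rw [SetLike.mem_coe]
      induction ha using Submodule.span_induction with
      | zero => rw [TensorProduct.tmul_zero]; exact Submodule.zero_mem _
      | add x y _ _ hx hy => rw [TensorProduct.tmul_add]; exact Submodule.add_mem _ hx hy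
      | smul r x _ hx => rw [TensorProduct.tmul_smul]; exact Submodule.smul_mem _ r hx
      | mem x hx =>
        obtain ⟨j, rfl⟩ := hx
        refine ⟨((c n)⁻¹ : ℂˣ).1 • v (j, n),
          Submodule.smul_mem _ _ (Submodule.subset_span ⟨_, rfl⟩), ?_⟩
        rw [map_smul]
        exact smul_smul _ _ _ |>.trans (by rw [Units.inv_mul, one_smul])
    obtain ⟨y, hy, hyx⟩ := h hx
    obtain rfl : y = ⟨x, hx⟩ := Subtype.ext hyx
    exact hy
  refine ⟨_, Module.Basis.mk hli hsp, fun j m => Subtype.ext ?_⟩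
  rw [Module.Basis.mk_apply, Module.Basis.mk_apply]
  change Lie.Derivation.ofDerivation 𝔤 laurentDeriv
    ((c m : ℂ) • (LaurentPolynomial.T (-(m + 1 : ℤ)) ⊗ₜ[ℂ] b j)) =
      (c (m + 1) : ℂ) • (LaurentPolynomial.T (-((m + 1 : ℕ) + 1 : ℤ)) ⊗ₜ[ℂ] b j)
  rw [map_smul, Lie.Derivation.ofDerivation_apply]
  change (c m : ℂ) • (laurentDeriv (LaurentPolynomial.T (-(m + 1 : ℤ))) ⊗ₜ[ℂ] b j) = _
  rw [laurentDeriv_T, ← TensorProduct.smul_tmul', smul_smul, hc]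
  congr 3

end

end NonlocalVA

theorem proposition3p20 :
    (∀ (L : Type u) [LieRing L] [LieAlgebra ℂ L] (d : LieDerivation ℂ L L)
        (I : Type*) [Countable I]
        (_ : Module.Basis I ℂ[X] (Module.AEval' (d : L →ₗ[ℂ] L))),
      (NonlocalVA.enveloping d).Nondegenerate) ∧
    (∀ (𝔤 : Type u) [LieRing 𝔤] [LieAlgebra ℂ 𝔤],
      Module.rank ℂ 𝔤 ≤ Cardinal.aleph0 →
      (NonlocalVA.enveloping (NonlocalVA.negCurrentDeriv 𝔤)).Nondegenerate) := by
  refine ⟨fun L _ _ d I _ b => ?_, fun 𝔤 _ _ _ => ?_⟩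
  · obtain ⟨e, he⟩ := NonlocalVA.exists_basis_of_basis_aeval (d : L →ₗ[ℂ] L) b
    exact NonlocalVA.enveloping_nondegenerate_of_basis d e he
  · obtain ⟨J, e, he⟩ := NonlocalVA.exists_basis_negCurrent 𝔤
    exact NonlocalVA.enveloping_nondegenerate_of_basis _ e he
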